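/- **Model.** Let $G$ be a finite directed tree consisting of a reverse multicast tree with root $C$ (leaves: the sources; links directed towards $C$), a link $CD$, and a multicast tree with root $D$ (leaves: the receivers; links directed away from $D$). Write $f(k)$ and $d(k)$ for the parents and children of $k$. Every node of the upper tree that is not a source has at least two parents (coding point), and every node of the lower tree that is not a receiver has at least two children (branching point); $C$ may itself be a source (one source) and $D$ a receiver (one receiver). A link above $C$ is named by its starting point, a link below $D$ by its end point. In an experiment link $e$ works with probability $\alpha_e$, independently of the other links; each source sends its own unit vector, coding points XOR the arriving packets and branching points copy, so coordinate $i$ of the packet at a receiver is $1$ iff the probe of source $i$ arrives there. An outcome $x$ is the family of packets at all receivers, $\Omega$ is the set of outcomes that can occur, and $p(x;\alpha)$ is the probability of $x$. Given counts $n(x)$, $x\in\Omega$, of the outcomes of $n=\sum_x n(x)$ independent experiments, an MLE is a maximizer of $\prod_{x\in\Omega}p(x;\alpha)^{n(x)}$ over $\alpha\in(0,1]^E$. **Algorithm.** For a node $k$ of the lower tree let $\hat\gamma^m_k$ be the proportion of experiments in which some receiver that is $k$ or a descendant of $k$ gets a nonzero packet (the data of the reduced multicast tree, whose aggregate link ends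 at $D$); for a node $k$ of the upper tree let $\hat\gamma^r_k$ be the proportion of experiments in which the probe of some source that is $k$ or an ancestor of $k$ is contained in a received packet (the data of the reduced reverse multicast tree, whose aggregate link starts at $C$). * MINC: $\hat A^m_k=\hat\gamma^m_k$ for receivers $k$; for the other nodes $k$ of the lower tree, $\hat A^m_k$ is the solution in $(\hat\gamma^m_k,\infty)$ of $1-\hat\gamma^m_k/A=\prod_{j\in d(k)}(1-\hat\gamma^m_j/A)$. For $k\ne D$, set $\hat\alpha_k=\hat A^m_k/\hat A^m_{f(k)}$. * RMINC: $\hat A^r_k=\hat\gamma^r_k$ for sources $k$; for the other nodes $k$ of the upper tree, $\hat A^r_k$ is the solution in $(\hat\gamma^r_k,\infty)$ of $1-\hat\gamma^r_k/A=\prod_{j\in f(k)}(1-\hat\gamma^r_j/A)$. For $k\ne C$, set $\hat\alpha_k=\hat A^r_k/\hat A^r_{d(k)}$. * Finally $\hat\alpha_{CD}=\hat A^r_C\,\hat A^m_D/\hat\gamma^m_D$. **Theorem.** 1. If $n(x)>0$ for every $x\in\Omega$, then the equations above have unique solutions in the stated intervals, so that the algorithm computes exactly one vector $\hat\alpha$;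 and if $\hat\alpha\in(0,1]^E$, then $\hat\alpha$ is the MLE, that is, the unique maximizer of the likelihood over $(0,1]^E$. 2. If the true success rates are $\alpha^0\in(0,1)^E$ and the experiments are independent with outcome distribution $p(\cdot\,;\alpha^0)$, then almost surely, for all sufficiently large $n$, the counts after $n$ experiments satisfy $n(x)>0$ for all $x\in\Omega$, the algorithm's output $\hat\alpha$ lies in $(0,1]^E$, and $\hat\alpha$ is the unique MLE. -/

import Mathlib

open MeasureTheory ProbabilityTheory Filter

/-- A finite rooted logical tree, given by the map `next` that moves every node one step towards the
root.  The root is the fixed end of `next`, and a node that is not a leaf has at least two branches.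

It serves for both kinds of trees.  Read downwards it is a *multicast tree*: probes flow from the
root to the leaves, `next k` is the parent of `k`, and the branches of `k` are its children.  Read
upwards it is a *reverse multicast tree*: probes flow from the leaves to the root, `next k` is the
child of `k`, and the branches of `k` are its parents. -/
structure LogicalTree (V : Type*) where
  root : V
  next : V → V
  next_root : next root = root
  reaches_root : ∀ v, ∃ n : ℕ, next^[n] v = root
  logical : ∀ j, j ≠ root → ∃ i, i ≠ root ∧ i ≠ j ∧ next i = next j

namespace LogicalTree

variable {V : Type*}

/-- `j` is a branch of `k`: the node adjacent to `k` on the side away from the root. -/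
def IsBranch (T : LogicalTree V) (j k : V) : Prop := j ≠ T.root ∧ T.next j = k

def IsLeaf (T : LogicalTree V) (k : V) : Prop := ∀ j, ¬ T.IsBranch j k

abbrev Leaf (T : LogicalTree V) : Type _ := {k : V // T.IsLeaf k}

/-- `k` lies on the path from `j` to the root (with `j = k` allowed). -/
def OnPath (T : LogicalTree V) (k j : V) : Prop := ∃ n : ℕ, T.next^[n] j = k

open Classical in
/-- The empirical frequency `γ̂ k`, from the number `c y` of experiments with outcome `y`: the
proportion of experiments in which the probe is recorded (value `true`) for at least one leaf whose
path to the root contains `k`. -/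
noncomputable def freq [Fintype V] (T : LogicalTree V) (c : (T.Leaf → Bool) → ℕ) (k : V) : ℝ :=
  (∑ y : T.Leaf → Bool,
      if ∃ j : T.Leaf, T.OnPath k j ∧ y j = true then (c y : ℝ) else 0) /
    ∑ y : T.Leaf → Bool, (c y : ℝ)

open Classical in
/-- The MINC estimator for a multicast tree and, with the same functional form, the RMINC estimator
for a reverse multicast tree.  The root of `T` is joined by one more link to an extra end node `0`
(the source of the multicast tree, the receiver of the reverse multicast tree); link `k` is the link
at `k` in the direction of `0`, so the links are indexed by all nodes of `T`.

`c` counts the outcomes, `A k` is the estimated probability that the path between `0` and `k` works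
(it is `1` for the end node `0`), and `a k` is the estimated success rate of link `k`. -/
structure IsMINC [Fintype V] (T : LogicalTree V) (c : (T.Leaf → Bool) → ℕ) (A a : V → ℝ) :
    Prop where
  leaf : ∀ k, T.IsLeaf k → A k = T.freq c k
  inner_gt : ∀ k, ¬ T.IsLeaf k → T.freq c k < A k
  inner_eq : ∀ k, ¬ T.IsLeaf k →
    1 - T.freq c k / A k =
      ∏ j ∈ Finset.univ.filter (fun j => T.IsBranch j k), (1 - T.freq c j / A k)
  rate_root : a T.root = A T.root
  rate : ∀ k, k ≠ T.root → a k = A k / A (T.next k)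

end LogicalTree

/-- The multi-source tree: `up` is the part from the sources (its leaves) down to its root `C`, `down`
is the part from its root `D` to the receivers (its leaves), and one link leads from `C` to `D`.  All
coding points are inner nodes of `up`, all branching points are inner nodes of `down`. -/
structure CodedTree (U W : Type*) where
  up : LogicalTree U
  down : LogicalTree W

namespace CodedTree

variable {U W : Type*}

abbrev C (G : CodedTree U W) : U := G.up.root

abbrev D (G : CodedTree U W) : W := G.down.root

abbrev Source (G : CodedTree U W) : Type _ := G.up.Leaf

abbrev Receiver (G : CodedTree U W) : Type _ := G.down.Leaf

/-- The links: those above `C`, named by their starting point, the link `CD`, and those below `D`,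
named by their end point. -/
abbrev Link (G : CodedTree U W) : Type _ := {k : U // k ≠ G.C} ⊕ Unit ⊕ {k : W // k ≠ G.D}

abbrev above (G : CodedTree U W) (k : {k : U // k ≠ G.C}) : G.Link := Sum.inl k

abbrev linkCD (G : CodedTree U W) : G.Link := Sum.inr (Sum.inl ())

abbrev below (G : CodedTree U W) (k : {k : W // k ≠ G.D}) : G.Link := Sum.inr (Sum.inr k)

/-- The starting point of a directed link. -/
def tail (G : CodedTree U W) : G.Link → U ⊕ W
  | Sum.inl k => Sum.inl k
  | Sum.inr (Sum.inl _) => Sum.inl G.C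
  | Sum.inr (Sum.inr k) => Sum.inr (G.down.next k)

/-- The end point of a directed link. -/
def head (G : CodedTree U W) : G.Link → U ⊕ W
  | Sum.inl k => Sum.inl (G.up.next k)
  | Sum.inr (Sum.inl _) => Sum.inr G.D
  | Sum.inr (Sum.inr k) => Sum.inr k

/-- A probe at node `v` arrives at node `v'` when exactly the links with `w e = true` work. -/
def Arrives (G : CodedTree U W) (w : G.Link → Bool) : U ⊕ W → U ⊕ W → Prop :=
  Relation.ReflTransGen (fun v v' => ∃ e : G.Link, w e = true ∧ G.tail e = v ∧ G.head e = v')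

open Classical in
/-- The packets at the receivers.  Source `s` sends the unit vector of `s`, coding points XOR the
packets that arrive, and branching points copy.  The packets that meet at a coding point come from
disjoint sets of sources, so nothing cancels: coordinate `s` of the packet at a node tells
whether the probe of source `s` arrives there. -/
noncomputable def observation (G : CodedTree U W) (w : G.Link → Bool) :
    G.Receiver → G.Source → Bool :=
  fun r s => decide (G.Arrives w (Sum.inl s.1) (Sum.inr r.1))

/-- The possible outcomes of an experiment. -/
abbrev Outcome (G : CodedTree U W) : Type _ :=
  {x : G.Receiver → G.Source → Bool // ∃ w, G.observation w = x}

open Classical in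
/-- The probability `p(x; α)` of outcome `x`, where the links `e` work independently with
probability `α e`. -/
noncomputable def prob [Fintype U] [Fintype W] (G : CodedTree U W) (α : G.Link → ℝ)
    (x : G.Outcome) : ℝ :=
  ∑ w : G.Link → Bool,
    if G.observation w = x.1 then ∏ e : G.Link, (if w e = true then α e else 1 - α e) else 0

open Classical in
/-- The probability of the data, with `N x` experiments of outcome `x`. -/
noncomputable def likelihood [Fintype U] [Fintype W] (G : CodedTree U W) (N : G.Outcome → ℕ)
    (α : G.Link → ℝ) : ℝ :=
  ∏ x : G.Outcome, G.prob α x ^ N x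

/-- The parameter space `(0,1]^E`. -/
def rates (G : CodedTree U W) : Set (G.Link → ℝ) := {α | ∀ e, 0 < α e ∧ α e ≤ 1}

/-- `α` is a maximum likelihood estimate. -/
def IsMLE [Fintype U] [Fintype W] (G : CodedTree U W) (N : G.Outcome → ℕ) (α : G.Link → ℝ) :
    Prop :=
  α ∈ G.rates ∧ ∀ β ∈ G.rates, G.likelihood N β ≤ G.likelihood N α

open Classical in
/-- The outcome counts of the reduced multicast tree: all that is kept of an outcome is which
receivers got a nonzero packet. -/
noncomputable def multicastCount [Fintype U] [Fintype W] (G : CodedTree U W)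
    (N : G.Outcome → ℕ) (y : G.Receiver → Bool) : ℕ :=
  ∑ x : G.Outcome, if ∀ r, y r = true ↔ ∃ s, x.1 r s = true then N x else 0

open Classical in
/-- The outcome counts of the reduced reverse multicast tree: all that is kept of an outcome is which
sources' probes got through to some receiver. -/
noncomputable def reverseCount [Fintype U] [Fintype W] (G : CodedTree U W)
    (N : G.Outcome → ℕ) (y : G.Source → Bool) : ℕ :=
  ∑ x : G.Outcome, if ∀ s, y s = true ↔ ∃ r, x.1 r s = true then N x else 0

/-- `α` is what the algorithm computes from the data: MINC on the reduced multicast tree (the part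
below `D`, with an aggregate link into `D`), RMINC on the reduced reverse multicast tree (the part
above `C`, with an aggregate link out of `C`), and `A^r_C * A^m_D / γ^m_D` for the link `CD`. -/
def IsAlgorithmOutput [Fintype U] [Fintype W] (G : CodedTree U W) (N : G.Outcome → ℕ)
    (α : G.Link → ℝ) : Prop :=
  ∃ (Am am : W → ℝ) (Ar ar : U → ℝ),
    G.down.IsMINC (G.multicastCount N) Am am ∧
    G.up.IsMINC (G.reverseCount N) Ar ar ∧
    (∀ k, α (G.below k) = am k.1) ∧
    (∀ k, α (G.above k) = ar k.1) ∧
    α G.linkCD = Ar G.C * Am G.D / G.down.freq (G.multicastCount N) G.D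

open Classical in
/-- The number of occurrences of each outcome among the first `n` of a sequence of experiments. -/
noncomputable def counts (G : CodedTree U W) (X : ℕ → G.Outcome) (n : ℕ) (x : G.Outcome) : ℕ :=
  ((Finset.range n).filter (fun t => X t = x)).card

end CodedTree

/-!
In either tree, the probability that a probe is seen to have passed through the node `k` is
`γ k = c * A k * β k`, where `A k` is the probability that the path from the root to `k` works,
`β k` the probability that some leaf beyond `k` is connected to `k`, and `c` does not depend on `k`.
Since `1 - β k = ∏ j, (1 - α j * β j)` over the branches `j` of `k`, the number `c * A k` solves the
equation `1 - γ k / A = ∏ j, (1 - γ j / A)` of the algorithm, and it is the only solution above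
`γ k` because `A * (1 - ∏ j, (1 - γ j / A))` is strictly increasing in `A`. So the algorithm
recovers `α` from the frequencies that `α` produces, and its output `α̂` is the only vector of rates
under which the model reproduces the observed frequencies.

The log-likelihood is a linear function of these frequencies. Hence the relative frequencies of the
outcomes and the distribution `p(·; α̂)` give the same mean to `log p(x; β)`, for every `β`, and
Gibbs' inequality shows that `p(·; β) = p(·; α̂)` for every maximizer `β`, so that `β = α̂`. Finally
the output is a continuous function of the relative frequencies, which by the strong law of large
numbers converge to `p(·; α₀)`, where the output is `α₀`.
-/

namespace LogicalTree

variable {V : Type*} {T : LogicalTree V} {i i' j k l : V}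

section Order

open Classical in
/-- The number of steps from a node to the root. -/
noncomputable def depth (T : LogicalTree V) (k : V) : ℕ := Nat.find (T.reaches_root k)

theorem depth_next (hj : j ≠ T.root) : T.depth j = T.depth (T.next j) + 1 := by
  classical exact Nat.find_comp_succ (T.reaches_root j) (T.reaches_root (T.next j)) hj

theorem onPath_refl (T : LogicalTree V) (k : V) : T.OnPath k k := ⟨0, rfl⟩

theorem onPath_next (T : LogicalTree V) (k : V) : T.OnPath (T.next k) k := ⟨1, rfl⟩

theorem onPath_root (T : LogicalTree V) (k : V) : T.OnPath T.root k := T.reaches_root k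

theorem OnPath.trans (h : T.OnPath i k) (h' : T.OnPath k j) : T.OnPath i j := by
  obtain ⟨n, rfl⟩ := h
  obtain ⟨m, rfl⟩ := h'
  exact ⟨n + m, Function.iterate_add_apply _ _ _ _⟩

theorem onPath_iff_eq_or : T.OnPath k j ↔ k = j ∨ T.OnPath k (T.next j) := by
  constructor
  · rintro ⟨_ | n, rfl⟩
    exacts [Or.inl rfl, Or.inr ⟨n, rfl⟩]
  · rintro (rfl | h)
    exacts [T.onPath_refl _, h.trans (T.onPath_next j)]

theorem OnPath.eq_root (h : T.OnPath k T.root) : k = T.root := by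
  obtain ⟨n, rfl⟩ := h
  exact Function.iterate_fixed T.next_root n

@[elab_as_elim]
theorem root_induction {P : V → Prop} (root : P T.root)
    (next : ∀ k, k ≠ T.root → P (T.next k) → P k) (k : V) : P k := by
  obtain ⟨n, hn⟩ := T.reaches_root k
  induction n generalizing k with
  | zero => rwa [show k = T.root from hn]
  | succ n ih =>
    by_cases hk : k = T.root
    · exact hk ▸ root
    · exact next k hk (ih _ hn)

theorem OnPath.depth_le (h : T.OnPath k j) : T.depth k ≤ T.depth j := by
  induction j using root_induction (T := T) with
  | root => rw [h.eq_root]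
  | next j hj ih =>
    rcases onPath_iff_eq_or.1 h with rfl | h
    · exact le_rfl
    · exact (ih h).trans (by rw [depth_next hj]; exact Nat.le_succ _)

theorem OnPath.eq_of_depth_le (h : T.OnPath k j) (hd : T.depth j ≤ T.depth k) : k = j := by
  by_cases hj : j = T.root
  · subst hj; exact h.eq_root
  · refine (onPath_iff_eq_or.1 h).resolve_right fun h' => ?_
    have := h'.depth_le
    have := depth_next hj
    lia

theorem OnPath.antisymm (h : T.OnPath k j) (h' : T.OnPath j k) : k = j :=
  h.eq_of_depth_le h'.depth_le

theorem OnPath.total (h : T.OnPath i j) (h' : T.OnPath i' j) :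
    T.OnPath i i' ∨ T.OnPath i' i := by
  obtain ⟨n, rfl⟩ := h
  obtain ⟨m, rfl⟩ := h'
  rcases le_total n m with hnm | hnm <;> obtain ⟨d, rfl⟩ := Nat.exists_eq_add_of_le' hnm
  · exact Or.inr ⟨d, (Function.iterate_add_apply _ _ _ _).symm⟩
  · exact Or.inl ⟨d, (Function.iterate_add_apply _ _ _ _).symm⟩

end Order

section Branches

theorem isBranch_next (hk : k ≠ T.root) : T.IsBranch k (T.next k) := ⟨hk, rfl⟩

theorem IsBranch.onPath (h : T.IsBranch j k) : T.OnPath k j := ⟨1, h.2⟩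

theorem IsBranch.depth_eq (h : T.IsBranch j k) : T.depth j = T.depth k + 1 := by
  rw [depth_next h.1, h.2]

theorem IsBranch.not_onPath (h : T.IsBranch j k) : ¬ T.OnPath j k := fun h' => by
  have := h'.depth_le
  have := h.depth_eq
  lia

theorem IsBranch.ne (h : T.IsBranch j k) : j ≠ k := by
  rintro rfl
  exact h.not_onPath (T.onPath_refl _)

theorem IsBranch.onPath_of_ne (h : T.IsBranch j k) (hi : T.OnPath i j) (hne : i ≠ j) :
    T.OnPath i k :=
  h.2 ▸ (onPath_iff_eq_or.1 hi).resolve_left hne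

theorem OnPath.exists_isBranch (h : T.OnPath k j) (hne : j ≠ k) :
    ∃ i, T.IsBranch i k ∧ T.OnPath i j := by
  induction j using root_induction (T := T) with
  | root => exact absurd h.eq_root.symm hne
  | next j hj ih =>
    by_cases hjk : T.next j = k
    · exact ⟨j, ⟨hj, hjk⟩, T.onPath_refl j⟩
    · obtain ⟨i, hi, hij⟩ := ih ((onPath_iff_eq_or.1 h).resolve_left hne.symm) hjk
      exact ⟨i, hi, hij.trans (T.onPath_next j)⟩

theorem IsBranch.eq_of_onPath (h : T.IsBranch i k) (h' : T.IsBranch i' k)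
    (hj : T.OnPath i j) (hj' : T.OnPath i' j) : i = i' := by
  have := h.depth_eq
  have := h'.depth_eq
  rcases hj.total hj' with e | e
  · exact e.eq_of_depth_le (by lia)
  · exact (e.eq_of_depth_le (by lia)).symm

theorem IsLeaf.eq_of_onPath (hk : T.IsLeaf k) (h : T.OnPath k j) : j = k := by
  by_contra hne
  obtain ⟨i, hi, -⟩ := h.exists_isBranch hne
  exact hk i hi

theorem not_isLeaf_iff : ¬ T.IsLeaf k ↔ ∃ j, T.IsBranch j k := by simp [IsLeaf]

@[elab_as_elim]
theorem branch_induction [Finite V] {P : V → Prop}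
    (branches : ∀ k, (∀ j, T.IsBranch j k → P j) → P k) (k : V) : P k := by
  let deeper : V → V → Prop := fun j k => T.depth k < T.depth j
  have : IsTrans V deeper := ⟨fun _ _ _ h h' => h'.trans h⟩
  have : Std.Irrefl deeper := ⟨fun _ => lt_irrefl _⟩
  refine (Finite.wellFounded_of_trans_of_irrefl deeper).induction k fun k ih => ?_
  exact branches k fun j hj => ih j (by simp only [deeper, hj.depth_eq, Nat.lt_succ_self])

theorem exists_leaf_onPath [Finite V] (T : LogicalTree V) (k : V) :
    ∃ l : T.Leaf, T.OnPath k l := by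
  induction k using branch_induction (T := T) with
  | branches k ih =>
    by_cases hk : T.IsLeaf k
    · exact ⟨⟨k, hk⟩, T.onPath_refl k⟩
    · obtain ⟨j, hj⟩ := not_isLeaf_iff.1 hk
      obtain ⟨l, hl⟩ := ih j hj
      exact ⟨l, hj.onPath.trans hl⟩

variable [Fintype V]

open Classical in
/-- The branches of `k` as a finite set: the index set of the products in the MINC equations. -/
noncomputable def branches (T : LogicalTree V) (k : V) : Finset V := {j | T.IsBranch j k}

theorem mem_branches : j ∈ T.branches k ↔ T.IsBranch j k := by simp [branches]

theorem branches_nontrivial (hk : ¬ T.IsLeaf k) : (T.branches k).Nontrivial := by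
  obtain ⟨j, hj⟩ := not_isLeaf_iff.1 hk
  obtain ⟨i, hi, hij, hnext⟩ := T.logical j hj.1
  exact ⟨j, mem_branches.2 hj, i, mem_branches.2 ⟨hi, hnext.trans hj.2⟩, hij.symm⟩

open Classical in
/-- The nodes strictly beyond `k`, as seen from the root: their links are the ones that decide which
leaves beyond `k` are connected to `k`. -/
noncomputable def beyond (T : LogicalTree V) (k : V) : Finset V := {j | T.OnPath k j ∧ j ≠ k}

theorem mem_beyond : j ∈ T.beyond k ↔ T.OnPath k j ∧ j ≠ k := by simp [beyond]

theorem ne_root_of_mem_beyond (hj : j ∈ T.beyond k) : j ≠ T.root := by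
  rintro rfl
  exact (mem_beyond.1 hj).2 (mem_beyond.1 hj).1.eq_root.symm

theorem onPath_next_of_mem_beyond (hj : j ∈ T.beyond k) : T.OnPath k (T.next j) :=
  (onPath_iff_eq_or.1 (mem_beyond.1 hj).1).resolve_left (mem_beyond.1 hj).2.symm

theorem notMem_beyond_self (k : V) : k ∉ T.beyond k := fun h => (mem_beyond.1 h).2 rfl

theorem beyond_eq_empty (hk : T.IsLeaf k) : T.beyond k = ∅ :=
  Finset.eq_empty_of_forall_notMem fun _ hj =>
    (mem_beyond.1 hj).2 (hk.eq_of_onPath (mem_beyond.1 hj).1)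

open Classical in
theorem mem_insert_beyond : i ∈ insert j (T.beyond j) ↔ T.OnPath j i := by
  rw [Finset.mem_insert, mem_beyond]
  by_cases h : i = j
  · simp [h, T.onPath_refl j]
  · simp [h]

open Classical in
theorem pairwiseDisjoint_insert_beyond (k : V) :
    (T.branches k : Set V).PairwiseDisjoint fun j => insert j (T.beyond j) := by
  refine fun j hj j' hj' hne => Finset.disjoint_left.2 fun i hi hi' => hne ?_
  exact (mem_branches.1 hj).eq_of_onPath (mem_branches.1 hj') (mem_insert_beyond.1 hi)
    (mem_insert_beyond.1 hi')

open Classical in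
theorem beyond_eq_biUnion (k : V) :
    T.beyond k = (T.branches k).biUnion fun j => insert j (T.beyond j) := by
  ext i
  simp only [Finset.mem_biUnion, mem_insert_beyond, mem_branches, mem_beyond]
  constructor
  · exact fun h => h.1.exists_isBranch h.2
  · rintro ⟨j, hj, hji⟩
    refine ⟨hj.onPath.trans hji, ?_⟩
    rintro rfl
    exact hj.not_onPath hji

theorem prod_beyond {M : Type*} [CommMonoid M] (k : V) (f : V → M) :
    ∏ i ∈ T.beyond k, f i = ∏ j ∈ T.branches k, (f j * ∏ i ∈ T.beyond j, f i) := by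
  classical
  rw [beyond_eq_biUnion, Finset.prod_biUnion (pairwiseDisjoint_insert_beyond k)]
  exact Finset.prod_congr rfl fun j _ => Finset.prod_insert (notMem_beyond_self j)

end Branches

end LogicalTree

section IndependentLinks

variable {E : Type*}

theorem dependsOn_forall {ι : Type*} {A : ι → (E → Bool) → Prop} {s : ι → Set E} (I : Finset ι)
    (h : ∀ i ∈ I, DependsOn (A i) (s i)) :
    DependsOn (fun w => ∀ i ∈ I, A i w) (⋃ i ∈ I, s i) := fun _ _ hw => propext <|
  forall₂_congr fun i hi => iff_of_eq <|
    h i hi fun e he => hw e (Set.mem_biUnion (s := (I : Set ι)) hi he)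

variable [Fintype E]

/-- The weight of the state `w` of a family of links, of which link `e` works with probability `p e`
independently of the others. -/
noncomputable def linkWeight (p : E → ℝ) (w : E → Bool) : ℝ := ∏ e, if w e then p e else 1 - p e

open Classical in
/-- The probability of the event `A` when link `e` works with probability `p e` independently of the
others. It is a polynomial in `p`, and is considered for every real vector `p`. -/
noncomputable def linkProb (p : E → ℝ) (A : (E → Bool) → Prop) : ℝ := ∑ w with A w, linkWeight p w

variable {p : E → ℝ} {A B : (E → Bool) → Prop} {s t : Set E}

theorem linkProb_eq_sum [DecidableEq E] (p : E → ℝ) (A : (E → Bool) → Prop) [DecidablePred A] :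
    linkProb p A = ∑ w with A w, linkWeight p w := by
  rw [linkProb]
  congr!

theorem linkWeight_nonneg (hp : ∀ e, 0 ≤ p e ∧ p e ≤ 1) (w : E → Bool) : 0 ≤ linkWeight p w :=
  Finset.prod_nonneg fun e _ => by
    split_ifs
    exacts [(hp e).1, sub_nonneg.2 (hp e).2]

theorem linkProb_mono (hp : ∀ e, 0 ≤ p e ∧ p e ≤ 1) (h : ∀ w, A w → B w) :
    linkProb p A ≤ linkProb p B := by
  classical
  exact Finset.sum_le_sum_of_subset_of_nonneg (Finset.monotone_filter_right _ fun w _ => h w)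
    fun w _ _ => linkWeight_nonneg hp w

theorem linkProb_nonneg (hp : ∀ e, 0 ≤ p e ∧ p e ≤ 1) (A : (E → Bool) → Prop) :
    0 ≤ linkProb p A :=
  Finset.sum_nonneg fun w _ => linkWeight_nonneg hp w

theorem linkProb_pos (hp : ∀ e, 0 < p e ∧ p e < 1) {w : E → Bool} (hw : A w) :
    0 < linkProb p A := by
  have hpos : ∀ w, 0 < linkWeight p w := fun w => Finset.prod_pos fun e _ => by
    split_ifs
    exacts [(hp e).1, sub_pos.2 (hp e).2]
  exact Finset.sum_pos (fun w _ => hpos w) ⟨w, by simpa using hw⟩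

theorem linkProb_cylinder {V : Type*} [Fintype V] {f : V → E} (hf : f.Injective) (p : E → ℝ)
    (v : V → Bool) : linkProb p (fun w => w ∘ f = v) = linkWeight (p ∘ f) v := by
  classical
  let allowed : E → Finset Bool := fun e => {b | ∀ k, f k = e → b = v k}
  have hcyl : ({w | w ∘ f = v} : Finset (E → Bool)) = Fintype.piFinset allowed := by
    ext w
    simp only [Finset.mem_filter_univ, funext_iff, Function.comp_apply, Fintype.mem_piFinset,
      allowed]
    exact ⟨fun h e k hk => hk ▸ h k, fun h k => h _ k rfl⟩
  have hfactor : ∀ k, ∑ b ∈ allowed (f k), (if b then p (f k) else 1 - p (f k)) =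
      if v k then p (f k) else 1 - p (f k) := fun k => by
    have : allowed (f k) = {v k} := by ext b; simp [allowed, hf.eq_iff]
    rw [this, Finset.sum_singleton]
  have hone : ∀ e, e ∉ Set.range f → ∑ b ∈ allowed e, (if b then p e else 1 - p e) = 1 := by
    intro e he
    have : allowed e = Finset.univ := Finset.filter_true_of_mem fun _ _ k hk => absurd ⟨k, hk⟩ he
    simp [this]
  rw [linkProb_eq_sum, hcyl]
  simp only [linkWeight]
  rw [← Finset.prod_univ_sum allowed fun e b => if b then p e else 1 - p e]
  exact (Fintype.prod_of_injective f hf _ _ hone fun k => (hfactor k).symm).symm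

theorem linkProb_comp {V : Type*} [Fintype V] {f : V → E} (hf : f.Injective) (p : E → ℝ)
    (A : (V → Bool) → Prop) : linkProb p (fun w => A (w ∘ f)) = linkProb (p ∘ f) A := by
  classical
  rw [linkProb, ← Finset.sum_fiberwise_of_maps_to (g := (· ∘ f)) (t := {v | A v})
    fun w hw => by simpa using hw]
  refine Finset.sum_congr rfl fun v hv => ?_
  rw [← linkProb_cylinder hf p v, linkProb_eq_sum, Finset.filter_filter]
  refine Finset.sum_congr (Finset.filter_congr fun w _ => ?_) fun _ _ => rfl
  exact and_iff_right_of_imp fun h => h ▸ (Finset.mem_filter.1 hv).2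

theorem linkProb_true (p : E → ℝ) : linkProb p (fun _ => True) = 1 := by
  have h := linkProb_cylinder (f := (Empty.elim : Empty → E)) (fun k => k.elim) p Empty.elim
  simpa [linkWeight, eq_iff_true_of_subsingleton] using h

theorem linkProb_coordinate (p : E → ℝ) (e : E) : linkProb p (fun w => w e) = p e := by
  have h := linkProb_cylinder (f := fun _ : Unit => e) (fun _ _ _ => rfl) p fun _ => true
  simpa [linkWeight, funext_iff] using h

theorem linkProb_not (p : E → ℝ) (A : (E → Bool) → Prop) :
    linkProb p (fun w => ¬ A w) = 1 - linkProb p A := by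
  classical
  rw [eq_sub_iff_add_eq', ← linkProb_true p, linkProb, linkProb, linkProb,
    Finset.sum_filter_add_sum_filter_not]
  simp

theorem linkProb_le_one (hp : ∀ e, 0 ≤ p e ∧ p e ≤ 1) (A : (E → Bool) → Prop) :
    linkProb p A ≤ 1 :=
  (linkProb_mono hp fun _ _ => trivial).trans_eq (linkProb_true p)

-- Exchanging the coordinates outside `s` between two independent copies of the links preserves the
-- joint weight. Both `A` and `B` occur for the first copy iff afterwards `A` occurs for the first
-- copy and `B` for the second.
theorem linkProb_and (p : E → ℝ) (hA : DependsOn A s) (hB : DependsOn B t) (hst : Disjoint s t) :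
    linkProb p (fun w => A w ∧ B w) = linkProb p A * linkProb p B := by
  classical
  let swap : (E → Bool) × (E → Bool) → (E → Bool) × (E → Bool) :=
    fun w => (s.piecewise w.1 w.2, s.piecewise w.2 w.1)
  have hswap : Function.Involutive swap := fun w => by
    ext e <;> by_cases he : e ∈ s <;> simp [swap, he]
  have hweight : ∀ w, linkWeight p (swap w).1 * linkWeight p (swap w).2 =
      linkWeight p w.1 * linkWeight p w.2 := fun w => by
    simp only [linkWeight, ← Finset.prod_mul_distrib]
    refine Finset.prod_congr rfl fun e _ => ?_
    by_cases he : e ∈ s <;> simp [swap, he, mul_comm]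
  have hevent : ∀ w, (A (swap w).1 ∧ B (swap w).2) ↔ A w.1 ∧ B w.1 := fun w => by
    rw [hA (y := w.1) fun e he => by simp [swap, he],
      hB (y := w.1) fun e he => by simp [swap, Set.disjoint_right.1 hst he]]
  rw [← mul_one (linkProb p fun w => A w ∧ B w), ← linkProb_true p]
  simp only [linkProb, Finset.sum_mul_sum, ← Finset.sum_product']
  refine Finset.sum_equiv hswap.toPerm (fun w => ?_) fun w _ => (hweight w).symm
  simp [hevent]

theorem linkProb_forall {ι : Type*} (p : E → ℝ) {A : ι → (E → Bool) → Prop} {s : ι → Set E}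
    {I : Finset ι} (h : ∀ i ∈ I, DependsOn (A i) (s i)) (hs : (I : Set ι).PairwiseDisjoint s) :
    linkProb p (fun w => ∀ i ∈ I, A i w) = ∏ i ∈ I, linkProb p (A i) := by
  classical
  induction I using Finset.induction_on with
  | empty => simpa using linkProb_true p
  | insert a I ha ih =>
    rw [Finset.forall_mem_insert] at h
    rw [Finset.coe_insert, Set.pairwiseDisjoint_insert_of_notMem (by simpa using ha)] at hs
    simp only [Finset.forall_mem_insert]
    rw [linkProb_and p h.1 (dependsOn_forall I h.2), ih h.2 hs.1, Finset.prod_insert ha]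
    exact Set.disjoint_iUnion₂_right.2 fun i hi => hs.2 i hi

end IndependentLinks

namespace LogicalTree

variable {V : Type*} {T : LogicalTree V} {i j k l : V} {s : V → Bool} {y : T.Leaf → Bool}

section Connections

/-- In the state `s`, where `s i` tells whether the link at `i` works, all links on the path from
`l` to `k` work. The link at `k` leads away from this path and is not counted. -/
def Conn (T : LogicalTree V) (s : V → Bool) (k l : V) : Prop :=
  ∀ i, T.OnPath k i → T.OnPath i l → i ≠ k → s i

/-- Some leaf beyond `k` is connected to `k`. -/
def Reaches (T : LogicalTree V) (s : V → Bool) (k : V) : Prop :=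
  ∃ l : T.Leaf, T.OnPath k l ∧ T.Conn s k l

/-- The leaves beyond `k` that are connected to `k` are exactly those marked by `y`. -/
def Pattern (T : LogicalTree V) (y : T.Leaf → Bool) (s : V → Bool) (k : V) : Prop :=
  ∀ l : T.Leaf, T.OnPath k l → (T.Conn s k l ↔ y l)

/-- Some leaf whose path to the root contains `k` is marked by `y`: the probe is known to have
passed through `k`. -/
def Hit (T : LogicalTree V) (y : T.Leaf → Bool) (k : V) : Prop :=
  ∃ l : T.Leaf, T.OnPath k l ∧ y l

theorem conn_self (s : V → Bool) (k : V) : T.Conn s k k := fun _ h h' hne =>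
  absurd (h'.antisymm h) hne

theorem conn_trans_iff (hik : T.OnPath i k) (hkl : T.OnPath k l) :
    T.Conn s i l ↔ T.Conn s i k ∧ T.Conn s k l := by
  constructor
  · refine fun h => ⟨fun j hj hjk => h j hj (hjk.trans hkl), fun j hj hjl hne =>
      h j (hik.trans hj) hjl ?_⟩
    rintro rfl
    exact hne (hik.antisymm hj)
  · rintro ⟨h1, h2⟩ j hj hjl hne
    by_cases hjk : T.OnPath j k
    · exact h1 j hj hjk hne
    · exact h2 j ((hkl.total hjl).resolve_right hjk) hjl fun e => hjk (e ▸ T.onPath_refl j)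

theorem IsBranch.conn_iff (h : T.IsBranch j k) : T.Conn s k j ↔ s j := by
  refine ⟨fun hc => hc j h.onPath (T.onPath_refl j) h.ne, fun hs i hki hij hne => ?_⟩
  by_cases e : i = j
  · exact e ▸ hs
  · exact absurd ((h.onPath_of_ne hij e).antisymm hki) hne

theorem conn_root_iff (hk : k ≠ T.root) :
    T.Conn s T.root k ↔ s k ∧ T.Conn s T.root (T.next k) := by
  rw [conn_trans_iff (T.onPath_root _) (T.onPath_next k), (isBranch_next hk).conn_iff, and_comm]

theorem IsBranch.conn_iff_of_onPath (h : T.IsBranch j k) (hl : T.OnPath j l) :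
    T.Conn s k l ↔ s j ∧ T.Conn s j l := by
  rw [conn_trans_iff h.onPath hl, h.conn_iff]

theorem reaches_of_forall [Finite V] (hs : ∀ i, s i) (k : V) : T.Reaches s k :=
  (T.exists_leaf_onPath k).imp fun _ hl => ⟨hl, fun i _ _ _ => hs i⟩

theorem IsBranch.reaches_sibling [Finite V] (h : T.IsBranch j k) (hs : ∀ i, s i ↔ i ≠ j) :
    T.Reaches s k := by
  obtain ⟨i, hi, hij, hnext⟩ := T.logical j h.1
  have hik : T.IsBranch i k := ⟨hi, hnext.trans h.2⟩
  obtain ⟨l, hl⟩ := T.exists_leaf_onPath i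
  refine ⟨l, hik.onPath.trans hl, fun i' _ hil _ => (hs i').2 ?_⟩
  rintro rfl
  exact hij (hik.eq_of_onPath h hl hil)

theorem IsBranch.conn_root (h : T.IsBranch j k) (hs : ∀ i, s i ↔ i ≠ j) : T.Conn s T.root k :=
  fun i _ hik _ => (hs i).2 fun e => h.not_onPath (e ▸ hik)

theorem IsBranch.not_conn_root (h : T.IsBranch j k) (hs : ∀ i, s i ↔ i ≠ j) :
    ¬ T.Conn s T.root j := fun hc => (hs j).1 ((conn_root_iff h.1).1 hc).1 rfl

theorem OnPath.hit (h : T.OnPath k j) (hy : T.Hit y j) : T.Hit y k := by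
  obtain ⟨l, hl, hy⟩ := hy
  exact ⟨l, h.trans hl, hy⟩

theorem hit_leaf (hk : T.IsLeaf k) : T.Hit y k ↔ y ⟨k, hk⟩ := by
  refine ⟨fun ⟨l, hl, hy⟩ => ?_, fun hy => ⟨⟨k, hk⟩, T.onPath_refl k, hy⟩⟩
  rwa [show l = ⟨k, hk⟩ from Subtype.ext (hk.eq_of_onPath hl)] at hy

theorem reaches_leaf (s : V → Bool) (hk : T.IsLeaf k) : T.Reaches s k :=
  ⟨⟨k, hk⟩, T.onPath_refl k, conn_self s k⟩

theorem pattern_leaf (hk : T.IsLeaf k) : T.Pattern y s k ↔ T.Hit y k := by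
  rw [hit_leaf hk]
  refine ⟨fun h => (h ⟨k, hk⟩ (T.onPath_refl k)).1 (conn_self s k), fun hy l hl => ?_⟩
  rw [show l = ⟨k, hk⟩ from Subtype.ext (hk.eq_of_onPath hl)]
  exact iff_of_true (conn_self s k) hy

theorem pattern_iff_not_reaches (hy : ¬ T.Hit y k) : T.Pattern y s k ↔ ¬ T.Reaches s k := by
  have hfalse : ∀ l : T.Leaf, T.OnPath k l → ¬ y l := fun l hl h => hy ⟨l, hl, h⟩
  simp only [Pattern, Reaches, not_exists, not_and]
  exact forall₂_congr fun l hl => iff_false_right (hfalse l hl)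

variable [Fintype V]

theorem exists_leaf_iff_exists_branches (hk : ¬ T.IsLeaf k) {P : T.Leaf → Prop} :
    (∃ l : T.Leaf, T.OnPath k l ∧ P l) ↔
      ∃ j ∈ T.branches k, ∃ l : T.Leaf, T.OnPath j l ∧ P l := by
  constructor
  · rintro ⟨l, hl, hP⟩
    obtain ⟨j, hj, hjl⟩ := hl.exists_isBranch fun e => hk (e ▸ l.2)
    exact ⟨j, mem_branches.2 hj, l, hjl, hP⟩
  · rintro ⟨j, hj, l, hl, hP⟩
    exact ⟨l, (mem_branches.1 hj).onPath.trans hl, hP⟩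

theorem hit_iff_exists_branches (hk : ¬ T.IsLeaf k) :
    T.Hit y k ↔ ∃ j ∈ T.branches k, T.Hit y j := exists_leaf_iff_exists_branches hk

theorem reaches_iff_exists_branches (hk : ¬ T.IsLeaf k) :
    T.Reaches s k ↔ ∃ j ∈ T.branches k, s j ∧ T.Reaches s j := by
  rw [Reaches, exists_leaf_iff_exists_branches hk]
  refine exists_congr fun j => and_congr_right fun hj => ?_
  rw [Reaches, ← exists_and_left]
  refine exists_congr fun l => ?_
  rw [and_left_comm]
  exact and_congr_right fun hl => (mem_branches.1 hj).conn_iff_of_onPath hl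

open Classical in
theorem pattern_iff_forall_branches (hk : ¬ T.IsLeaf k) :
    T.Pattern y s k ↔ ∀ j ∈ T.branches k,
      if T.Hit y j then s j ∧ T.Pattern y s j else ¬ (s j ∧ T.Reaches s j) := by
  have hpattern : T.Pattern y s k ↔
      ∀ j ∈ T.branches k, ∀ l : T.Leaf, T.OnPath j l → (s j ∧ T.Conn s j l ↔ y l) := by
    constructor
    · intro h j hj l hl
      have hj := mem_branches.1 hj
      rw [← h l (hj.onPath.trans hl), hj.conn_iff_of_onPath hl]
    · intro h l hl
      obtain ⟨j, hj, hjl⟩ := hl.exists_isBranch fun e => hk (e ▸ l.2)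
      rw [hj.conn_iff_of_onPath hjl, h j (mem_branches.2 hj) l hjl]
  refine hpattern.trans (forall₂_congr fun j _ => ?_)
  split_ifs with hy
  · refine ⟨fun h => ?_, fun ⟨hs, h⟩ l hl => by simpa [hs] using h l hl⟩
    obtain ⟨l, hl, hyl⟩ := hy
    have hs : s j := ((h l hl).2 hyl).1
    exact ⟨hs, fun l hl => by simpa [hs] using h l hl⟩
  · have hfalse : ∀ l : T.Leaf, T.OnPath j l → ¬ y l := fun l hl h => hy ⟨l, hl, h⟩
    simp only [Reaches, not_and, not_exists]
    exact ⟨fun h hs l hl hc => hfalse l hl ((h l hl).1 ⟨hs, hc⟩), fun h l hl =>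
      iff_of_false (fun hc => h hc.1 l hl hc.2) (hfalse l hl)⟩

end Connections

section Probabilities

theorem dependsOn_coordinate (k : V) : DependsOn (fun s : V → Bool => (s k : Prop)) {k} :=
  fun _ _ h => by simp only [h k rfl]

theorem dependsOn_conn (k l : V) :
    DependsOn (fun s => T.Conn s k l) {i | T.OnPath k i ∧ T.OnPath i l ∧ i ≠ k} := by
  refine fun _ _ h => forall_congr fun i => propext ?_
  exact forall₃_congr fun hki hil hne => by rw [h i ⟨hki, hil, hne⟩]

theorem dependsOn_conn_root_and_reaches (k : V) :
    DependsOn (fun s => T.Conn s T.root k ∧ T.Reaches s k) {i | i ≠ T.root} := fun _ _ h =>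
  congrArg₂ And (dependsOn_conn _ _ fun i hi => h i hi.2.2) <|
    propext <| exists_congr fun _ => and_congr_right fun _ => iff_of_eq <|
      dependsOn_conn _ _ fun i ⟨hki, _, hne⟩ => h i fun hi =>
        hne (hi.trans (OnPath.eq_root (hi ▸ hki)).symm)

variable [Fintype V] {p : V → ℝ}

theorem dependsOn_conn_beyond (k l : V) :
    DependsOn (fun s => T.Conn s k l) (T.beyond k : Set V) :=
  (dependsOn_conn k l).mono fun _ hi => mem_beyond.2 ⟨hi.1, hi.2.2⟩

theorem dependsOn_reaches (k : V) : DependsOn (fun s => T.Reaches s k) (T.beyond k : Set V) :=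
  fun _ _ h => propext <| exists_congr fun _ => and_congr_right fun _ =>
    iff_of_eq (dependsOn_conn_beyond k _ h)

theorem dependsOn_pattern (y : T.Leaf → Bool) (k : V) :
    DependsOn (fun s => T.Pattern y s k) (T.beyond k : Set V) :=
  fun _ _ h => propext <| forall₂_congr fun _ _ =>
    iff_congr (iff_of_eq (dependsOn_conn_beyond k _ h)) Iff.rfl

/-- The probability that all links on the path from `k` to the root work. -/
noncomputable def pathProb (T : LogicalTree V) (p : V → ℝ) (k : V) : ℝ :=
  linkProb p fun s => T.Conn s T.root k

/-- The probability that some leaf beyond `k` is connected to `k`. -/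
noncomputable def reachProb (T : LogicalTree V) (p : V → ℝ) (k : V) : ℝ :=
  linkProb p fun s => T.Reaches s k

/-- The probability that the leaves beyond `k` that are connected to `k` are those marked by `y`. -/
noncomputable def patternProb (T : LogicalTree V) (p : V → ℝ) (y : T.Leaf → Bool) (k : V) : ℝ :=
  linkProb p fun s => T.Pattern y s k

theorem linkProb_and_of_dependsOn_beyond (p : V → ℝ) {A : (V → Bool) → Prop}
    (hA : DependsOn A (T.beyond k : Set V)) :
    linkProb p (fun s => s k ∧ A s) = p k * linkProb p A := by
  rw [linkProb_and p (dependsOn_coordinate k) hA, linkProb_coordinate]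
  exact Set.disjoint_singleton_left.2 (notMem_beyond_self k)

theorem pathProb_root (T : LogicalTree V) (p : V → ℝ) : T.pathProb p T.root = 1 := by
  simp [pathProb, conn_self, linkProb_true]

theorem pathProb_eq_mul (p : V → ℝ) (hk : k ≠ T.root) :
    T.pathProb p k = p k * T.pathProb p (T.next k) := by
  simp only [pathProb, conn_root_iff hk]
  rw [linkProb_and p (dependsOn_coordinate k) (dependsOn_conn _ _), linkProb_coordinate]
  exact Set.disjoint_singleton_left.2 fun h => (isBranch_next hk).not_onPath h.2.1

theorem linkProb_conn_and_reaches (p : V → ℝ) (k : V) :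
    linkProb p (fun s => T.Conn s T.root k ∧ T.Reaches s k) =
      T.pathProb p k * T.reachProb p k := by
  refine linkProb_and p (dependsOn_conn _ _) (dependsOn_reaches k) (Set.disjoint_left.2 ?_)
  exact fun i hi hi' => (mem_beyond.1 hi').2 (hi.2.1.antisymm (mem_beyond.1 hi').1)

theorem pathProb_pos (hp : ∀ k, 0 < p k) (k : V) : 0 < T.pathProb p k := by
  induction k using root_induction (T := T) with
  | root => exact (T.pathProb_root p).symm ▸ one_pos
  | next k hk ih => exact pathProb_eq_mul p hk ▸ mul_pos (hp k) ih

theorem reachProb_leaf (p : V → ℝ) (hk : T.IsLeaf k) : T.reachProb p k = 1 := by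
  simp [reachProb, reaches_leaf _ hk, linkProb_true]

theorem patternProb_leaf (p : V → ℝ) (hk : T.IsLeaf k) (hy : T.Hit y k) :
    T.patternProb p y k = 1 := by
  simp [patternProb, pattern_leaf hk, hy, linkProb_true]

theorem patternProb_of_not_hit (p : V → ℝ) (hy : ¬ T.Hit y k) :
    T.patternProb p y k = 1 - T.reachProb p k := by
  simp only [patternProb, pattern_iff_not_reaches hy]
  exact linkProb_not p _

open Classical in
theorem patternProb_eq_prod_branches (p : V → ℝ) (y : T.Leaf → Bool) (hk : ¬ T.IsLeaf k) :
    T.patternProb p y k = ∏ j ∈ T.branches k,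
      if T.Hit y j then p j * T.patternProb p y j else 1 - p j * T.reachProb p j := by
  simp only [patternProb, pattern_iff_forall_branches hk]
  rw [linkProb_forall p (s := fun j => ((insert j (T.beyond j) : Finset V) : Set V))]
  · refine Finset.prod_congr rfl fun j _ => ?_
    split_ifs
    · exact linkProb_and_of_dependsOn_beyond p (dependsOn_pattern y j)
    · rw [linkProb_not, linkProb_and_of_dependsOn_beyond p (dependsOn_reaches j), reachProb]
  · intro j _ s s' h
    have hj : s j = s' j := h j (by simp)
    have hbeyond : ∀ i ∈ (T.beyond j : Set V), s i = s' i := fun i hi => h i (by simp_all)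
    simp only [hj, dependsOn_pattern y j hbeyond, dependsOn_reaches j hbeyond]
  · exact fun i hi j hj hne => Finset.disjoint_coe.2 (pairwiseDisjoint_insert_beyond k hi hj hne)

theorem one_sub_reachProb (p : V → ℝ) (hk : ¬ T.IsLeaf k) :
    1 - T.reachProb p k = ∏ j ∈ T.branches k, (1 - p j * T.reachProb p j) := by
  have hnot : ∀ j, ¬ T.Hit (fun _ => false) j := fun j ⟨_, _, h⟩ => Bool.false_ne_true h
  rw [← patternProb_of_not_hit p (hnot k), patternProb_eq_prod_branches p _ hk]
  simp only [hnot, if_false]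

theorem reachProb_le_one (hp : ∀ k, 0 ≤ p k ∧ p k ≤ 1) (k : V) : T.reachProb p k ≤ 1 :=
  linkProb_le_one hp _

theorem reachProb_pos (hp : ∀ k, 0 < p k ∧ p k ≤ 1) (k : V) : 0 < T.reachProb p k := by
  induction k using branch_induction (T := T) with
  | branches k ih =>
    by_cases hk : T.IsLeaf k
    · exact (reachProb_leaf p hk).symm ▸ one_pos
    · obtain ⟨j, hj⟩ := (branches_nontrivial hk).nonempty
      calc 0 < p j * T.reachProb p j := mul_pos (hp j).1 (ih j (mem_branches.1 hj))
        _ = linkProb p (fun s => s j ∧ T.Reaches s j) :=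
          (linkProb_and_of_dependsOn_beyond p (dependsOn_reaches j)).symm
        _ ≤ T.reachProb p k := linkProb_mono (fun k => ⟨(hp k).1.le, (hp k).2⟩) fun s hs =>
          (reaches_iff_exists_branches hk).2 ⟨j, hj, hs⟩

open Classical in
theorem patternProb_of_hit (p : V → ℝ) (hy : T.Hit y k) :
    T.patternProb p y k = ∏ j ∈ T.beyond k,
      if T.Hit y j then p j
      else if T.Hit y (T.next j) then 1 - p j * T.reachProb p j else 1 := by
  induction k using branch_induction (T := T) with
  | branches k ih =>
    by_cases hk : T.IsLeaf k
    · rw [patternProb_leaf p hk hy, beyond_eq_empty hk, Finset.prod_empty]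
    rw [patternProb_eq_prod_branches p y hk, prod_beyond]
    refine Finset.prod_congr rfl fun j hj => ?_
    have hj := mem_branches.1 hj
    by_cases hyj : T.Hit y j
    · rw [if_pos hyj, if_pos hyj, ih j hj hyj]
    · have hbeyond : ∀ i ∈ T.beyond j, ¬ T.Hit y i ∧ ¬ T.Hit y (T.next i) := fun i hi => by
        obtain ⟨hji, hne⟩ := mem_beyond.1 hi
        have hnext := (onPath_iff_eq_or.1 hji).resolve_left hne.symm
        exact ⟨fun h => hyj (hji.hit h), fun h => hyj (hnext.hit h)⟩
      rw [if_neg hyj, if_neg hyj, hj.2, if_pos hy, Finset.prod_eq_one, mul_one]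
      exact fun i hi => by rw [if_neg (hbeyond i hi).1, if_neg (hbeyond i hi).2]

end Probabilities

end LogicalTree

section MincEquation

variable {ι : Type*} {S : Finset ι} {x : ι → ℝ} {c A B : ℝ}

/-- The frequency that a node would need for `A` to solve its MINC equation, when its branches `S`
have the frequencies `x`. -/
noncomputable def mincFun (S : Finset ι) (x : ι → ℝ) (A : ℝ) : ℝ := A * (1 - ∏ j ∈ S, (1 - x j / A))

theorem mincFun_eq_iff (hA : A ≠ 0) :
    mincFun S x A = c ↔ 1 - c / A = ∏ j ∈ S, (1 - x j / A) := by
  rw [mincFun, mul_comm, ← eq_div_iff hA, sub_eq_iff_eq_add, sub_eq_iff_eq_add, add_comm]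

theorem mincFun_insert [DecidableEq ι] {a : ι} (ha : a ∉ S) (x : ι → ℝ) (hA : A ≠ 0) :
    mincFun (insert a S) x A = x a + (1 - x a / A) * mincFun S x A := by
  rw [mincFun, mincFun, Finset.prod_insert ha]
  field_simp
  ring

theorem mincFun_nonneg (hx : ∀ j ∈ S, 0 ≤ x j ∧ x j ≤ A) (hA : 0 ≤ A) : 0 ≤ mincFun S x A := by
  refine mul_nonneg hA (sub_nonneg.2 (Finset.prod_le_one (fun j hj => ?_) fun j hj => ?_))
  · exact sub_nonneg.2 (div_le_one_of_le₀ (hx j hj).2 hA)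
  · exact sub_le_self _ (div_nonneg (hx j hj).1 hA)

theorem mincFun_le_mincFun (hA : 0 < A) (hAB : A ≤ B) (hx : ∀ j ∈ S, 0 ≤ x j ∧ x j ≤ A) :
    mincFun S x A ≤ mincFun S x B := by
  classical
  induction S using Finset.induction_on with
  | empty => simp [mincFun]
  | insert a S ha ih =>
    rw [Finset.forall_mem_insert] at hx
    rw [mincFun_insert ha x hA.ne', mincFun_insert ha x (hA.trans_le hAB).ne']
    have hfactor : 0 ≤ 1 - x a / B :=
      sub_nonneg.2 (div_le_one_of_le₀ (hx.1.2.trans hAB) (hA.le.trans hAB))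
    have := mincFun_nonneg hx.2 hA.le
    have := hx.1.1
    gcongr
    exact ih hx.2

theorem mincFun_pos (hS : S.Nonempty) (hx : ∀ j ∈ S, 0 < x j ∧ x j ≤ A) : 0 < mincFun S x A := by
  classical
  obtain ⟨a, ha⟩ := hS
  have hA : 0 < A := (hx a ha).1.trans_le (hx a ha).2
  rw [← Finset.insert_erase ha, mincFun_insert (Finset.notMem_erase a S) x hA.ne']
  refine add_pos_of_pos_of_nonneg (hx a ha).1 (mul_nonneg ?_ (mincFun_nonneg ?_ hA.le))
  · exact sub_nonneg.2 (div_le_one_of_le₀ (hx a ha).2 hA.le)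
  · exact fun j hj => (hx j (Finset.mem_of_mem_erase hj)).imp_left le_of_lt

theorem strictMonoOn_mincFun (hS : S.Nontrivial) (hx : ∀ j ∈ S, 0 < x j ∧ x j ≤ c) :
    StrictMonoOn (mincFun S x) (Set.Ici c) := by
  classical
  intro A (hcA : c ≤ A) B _ hAB
  obtain ⟨a, ha, b, hb, hab⟩ := hS
  have hxA : ∀ j ∈ S, 0 < x j ∧ x j ≤ A := fun j hj => (hx j hj).imp_right (·.trans hcA)
  have hxA' : ∀ j ∈ S.erase a, 0 < x j ∧ x j ≤ A := fun j hj => hxA j (Finset.mem_of_mem_erase hj)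
  obtain ⟨ha0, haA⟩ := hxA a ha
  have hA : 0 < A := ha0.trans_le haA
  have hpos : 0 < mincFun (S.erase a) x A :=
    mincFun_pos ⟨b, Finset.mem_erase.2 ⟨hab.symm, hb⟩⟩ hxA'
  have hle : mincFun (S.erase a) x A ≤ mincFun (S.erase a) x B :=
    mincFun_le_mincFun hA hAB.le fun j hj => (hxA' j hj).imp_left le_of_lt
  have hfactor : 1 - x a / A < 1 - x a / B := by gcongr
  have hfactor0 : 0 ≤ 1 - x a / A := sub_nonneg.2 (div_le_one_of_le₀ haA hA.le)
  rw [← Finset.insert_erase ha, mincFun_insert (Finset.notMem_erase a S) x hA.ne',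
    mincFun_insert (Finset.notMem_erase a S) x (hA.trans hAB).ne', add_lt_add_iff_left]
  exact mul_lt_mul hfactor hle hpos (hfactor0.trans hfactor.le)

theorem continuousOn_mincFun (S : Finset ι) (x : ι → ℝ) :
    ContinuousOn (mincFun S x) (Set.Ioi 0) :=
  continuousOn_id.mul <| continuousOn_const.sub <| continuousOn_finsetProd _ fun _ _ =>
    continuousOn_const.sub (continuousOn_const.div continuousOn_id fun _ hA => (ne_of_gt hA))

theorem tendsto_mincFun_atTop (S : Finset ι) (x : ι → ℝ) :
    Tendsto (mincFun S x) atTop (nhds (∑ j ∈ S, x j)) := by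
  classical
  induction S using Finset.induction_on with
  | empty => simp [show mincFun ∅ x = fun _ => 0 by ext; simp [mincFun]]
  | insert a S ha ih =>
    have hfactor : Tendsto (fun A => 1 - x a / A) atTop (nhds (1 - 0)) :=
      tendsto_const_nhds.sub (tendsto_const_nhds.div_atTop tendsto_id)
    rw [Finset.sum_insert ha, ← one_mul (∑ j ∈ S, x j), ← sub_zero (1 : ℝ)]
    refine (tendsto_const_nhds.add (hfactor.mul ih)).congr' ?_
    filter_upwards [eventually_ne_atTop 0] with A hA
    exact (mincFun_insert ha x hA).symm

theorem tendsto_mincFun {β : Type*} {l : Filter β} {u : β → ι → ℝ}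
    (hu : ∀ j ∈ S, Tendsto (fun n => u n j) l (nhds (x j))) (A : ℝ) :
    Tendsto (fun n => mincFun S (u n) A) l (nhds (mincFun S x A)) :=
  tendsto_const_nhds.mul <| tendsto_const_nhds.sub <| tendsto_finsetProd _ fun j hj =>
    tendsto_const_nhds.sub ((hu j hj).div_const A)

/-- The inequalities between the frequency `c` of a node and the frequencies `x` of its branches
`S` under which the MINC equation of the node has exactly one solution in `(c, ∞)`. -/
structure MincSolvable (S : Finset ι) (x : ι → ℝ) (c : ℝ) : Prop where
  nontrivial : S.Nontrivial
  pos : ∀ j ∈ S, 0 < x j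
  lt : ∀ j ∈ S, x j < c
  lt_sum : c < ∑ j ∈ S, x j

/-- The solution of the MINC equation in `(c, ∞)`; a junk value if there is none. -/
noncomputable def mincRoot (S : Finset ι) (x : ι → ℝ) (c : ℝ) : ℝ :=
  Classical.epsilon fun A => c < A ∧ mincFun S x A = c

namespace MincSolvable

theorem freq_pos (h : MincSolvable S x c) : 0 < c := by
  obtain ⟨j, hj⟩ := h.nontrivial.nonempty
  exact (h.pos j hj).trans (h.lt j hj)

theorem strictMonoOn (h : MincSolvable S x c) : StrictMonoOn (mincFun S x) (Set.Ici c) :=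
  strictMonoOn_mincFun h.nontrivial fun j hj => ⟨h.pos j hj, (h.lt j hj).le⟩

theorem exists_root (h : MincSolvable S x c) : ∃ A, c < A ∧ mincFun S x A = c := by
  have hlow : mincFun S x c < c := by
    have : 0 < ∏ j ∈ S, (1 - x j / c) := Finset.prod_pos fun j hj =>
      sub_pos.2 ((div_lt_one h.freq_pos).2 (h.lt j hj))
    exact mul_lt_of_lt_one_right h.freq_pos (sub_lt_self _ this)
  obtain ⟨B, hB, hcB⟩ := (((tendsto_mincFun_atTop S x).eventually_const_lt h.lt_sum).and
    (eventually_ge_atTop c)).exists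
  obtain ⟨A, hA, hAc⟩ := intermediate_value_Icc hcB
    ((continuousOn_mincFun S x).mono fun A hA => h.freq_pos.trans_le hA.1) ⟨hlow.le, hB.le⟩
  refine ⟨A, hA.1.lt_of_ne ?_, hAc⟩
  rintro rfl
  exact hlow.ne hAc

theorem lt_mincRoot (h : MincSolvable S x c) : c < mincRoot S x c :=
  (Classical.epsilon_spec h.exists_root).1

theorem mincRoot_pos (h : MincSolvable S x c) : 0 < mincRoot S x c :=
  h.freq_pos.trans h.lt_mincRoot

theorem mincFun_mincRoot (h : MincSolvable S x c) : mincFun S x (mincRoot S x c) = c :=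
  (Classical.epsilon_spec h.exists_root).2

theorem eq_mincRoot (h : MincSolvable S x c) (hA : c < A) (hAc : mincFun S x A = c) :
    A = mincRoot S x c :=
  h.strictMonoOn.injOn hA.le h.lt_mincRoot.le (hAc.trans h.mincFun_mincRoot.symm)

theorem lt_mincRoot_iff (h : MincSolvable S x c) (hB : c < B) :
    B < mincRoot S x c ↔ mincFun S x B < c := by
  rw [← h.strictMonoOn.lt_iff_lt hB.le h.lt_mincRoot.le, h.mincFun_mincRoot]

theorem mincRoot_lt_iff (h : MincSolvable S x c) (hB : c < B) :
    mincRoot S x c < B ↔ c < mincFun S x B := by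
  rw [← h.strictMonoOn.lt_iff_lt h.lt_mincRoot.le hB.le, h.mincFun_mincRoot]

variable {β : Type*} {l : Filter β} {u : β → ι → ℝ} {v : β → ℝ}

theorem eventually_of_tendsto (h : MincSolvable S x c)
    (hu : ∀ j ∈ S, Tendsto (fun n => u n j) l (nhds (x j))) (hv : Tendsto v l (nhds c)) :
    ∀ᶠ n in l, MincSolvable S (u n) (v n) := by
  have hpos := fun j hj => (hu j hj).eventually_const_lt (h.pos j hj)
  have hlt := fun j hj => (hu j hj).eventually_lt hv (h.lt j hj)
  filter_upwards [(eventually_all_finset S).2 hpos, (eventually_all_finset S).2 hlt,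
    hv.eventually_lt (tendsto_finsetSum S hu) h.lt_sum] with n hpos hlt hsum
  exact ⟨h.nontrivial, hpos, hlt, hsum⟩

theorem tendsto_mincRoot (h : MincSolvable S x c)
    (hu : ∀ j ∈ S, Tendsto (fun n => u n j) l (nhds (x j))) (hv : Tendsto v l (nhds c)) :
    Tendsto (fun n => mincRoot S (u n) (v n)) l (nhds (mincRoot S x c)) := by
  have hsolv := h.eventually_of_tendsto hu hv
  refine tendsto_order.2 ⟨fun b hb => ?_, fun b hb => ?_⟩
  · obtain ⟨B, hbB, hB⟩ := exists_between (max_lt hb h.lt_mincRoot)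
    obtain ⟨hbB, hcB⟩ := max_lt_iff.1 hbB
    filter_upwards [hsolv, hv.eventually_lt_const hcB,
      (tendsto_mincFun hu B).eventually_lt hv ((h.lt_mincRoot_iff hcB).1 hB)] with n hn hvB hlt
    exact hbB.trans ((hn.lt_mincRoot_iff hvB).2 hlt)
  · have hcb : c < b := h.lt_mincRoot.trans hb
    filter_upwards [hsolv, hv.eventually_lt_const hcb,
      hv.eventually_lt (tendsto_mincFun hu b) ((h.mincRoot_lt_iff hcb).1 hb)] with n hn hvb hlt
    exact (hn.mincRoot_lt_iff hvb).2 hlt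

end MincSolvable

end MincEquation

namespace LogicalTree

section Estimator

variable {V : Type*} {T : LogicalTree V} {γ A a p : V → ℝ} {k : V}

open Classical in
/-- The link rates that belong to the probabilities `A k` of the paths from the extra end node,
which is adjacent to the root, to the nodes `k`. -/
noncomputable def linkRate (T : LogicalTree V) (A : V → ℝ) (k : V) : ℝ :=
  if k = T.root then A k else A k / A (T.next k)

theorem linkRate_root (T : LogicalTree V) (A : V → ℝ) : T.linkRate A T.root = A T.root := if_pos rfl

theorem linkRate_of_ne_root (A : V → ℝ) (hk : k ≠ T.root) :
    T.linkRate A k = A k / A (T.next k) := if_neg hk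

theorem eq_linkRate_iff :
    a = T.linkRate A ↔ a T.root = A T.root ∧ ∀ k, k ≠ T.root → a k = A k / A (T.next k) := by
  constructor
  · rintro rfl
    exact ⟨T.linkRate_root A, fun k hk => linkRate_of_ne_root A hk⟩
  · rintro ⟨hroot, hrate⟩
    funext k
    by_cases hk : k = T.root
    · rw [hk, hroot, linkRate_root]
    · rw [hrate k hk, linkRate_of_ne_root A hk]

variable [Fintype V]

/-- The MINC equations for the frequencies `γ` have exactly one solution at every node, and it is
positive. -/
structure Regular (T : LogicalTree V) (γ : V → ℝ) : Prop where
  leaf_pos : ∀ k, T.IsLeaf k → 0 < γ k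
  solvable : ∀ k, ¬ T.IsLeaf k → MincSolvable (T.branches k) γ (γ k)

open Classical in
/-- The MINC estimates `Â k` of the path probabilities, computed from the frequencies `γ`. -/
noncomputable def pathEstimate (T : LogicalTree V) (γ : V → ℝ) (k : V) : ℝ :=
  if T.IsLeaf k then γ k else mincRoot (T.branches k) γ (γ k)

theorem pathEstimate_leaf (γ : V → ℝ) (hk : T.IsLeaf k) : T.pathEstimate γ k = γ k := if_pos hk

theorem pathEstimate_inner (γ : V → ℝ) (hk : ¬ T.IsLeaf k) :
    T.pathEstimate γ k = mincRoot (T.branches k) γ (γ k) := if_neg hk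

namespace Regular

theorem freq_pos (h : T.Regular γ) (k : V) : 0 < γ k := by
  by_cases hk : T.IsLeaf k
  exacts [h.leaf_pos k hk, (h.solvable k hk).freq_pos]

theorem pathEstimate_pos (h : T.Regular γ) (k : V) : 0 < T.pathEstimate γ k := by
  by_cases hk : T.IsLeaf k
  · exact (pathEstimate_leaf γ hk).symm ▸ h.leaf_pos k hk
  · exact (pathEstimate_inner γ hk).symm ▸ (h.solvable k hk).mincRoot_pos

theorem lt_pathEstimate (h : T.Regular γ) (hk : ¬ T.IsLeaf k) : γ k < T.pathEstimate γ k :=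
  (pathEstimate_inner γ hk).symm ▸ (h.solvable k hk).lt_mincRoot

theorem mincEquation (h : T.Regular γ) (hk : ¬ T.IsLeaf k) :
    1 - γ k / T.pathEstimate γ k = ∏ j ∈ T.branches k, (1 - γ j / T.pathEstimate γ k) := by
  rw [← mincFun_eq_iff (h.pathEstimate_pos k).ne', pathEstimate_inner γ hk]
  exact (h.solvable k hk).mincFun_mincRoot

theorem isMINC_iff {c : (T.Leaf → Bool) → ℕ} (h : T.Regular (T.freq c)) :
    T.IsMINC c A a ↔ A = T.pathEstimate (T.freq c) ∧ a = T.linkRate A := by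
  constructor
  · refine fun hA => ⟨funext fun k => ?_, eq_linkRate_iff.2 ⟨hA.rate_root, hA.rate⟩⟩
    by_cases hk : T.IsLeaf k
    · rw [hA.leaf k hk, pathEstimate_leaf _ hk]
    · rw [pathEstimate_inner _ hk]
      exact (h.solvable k hk).eq_mincRoot (hA.inner_gt k hk)
        ((mincFun_eq_iff ((h.freq_pos k).trans (hA.inner_gt k hk)).ne').2 (hA.inner_eq k hk))
  · rintro ⟨rfl, rfl⟩
    exact ⟨fun k => pathEstimate_leaf _, fun k => h.lt_pathEstimate, fun k => h.mincEquation,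
      T.linkRate_root _, fun k => linkRate_of_ne_root _⟩

theorem reachProb_eq (h : T.Regular γ)
    (hp : ∀ k, k ≠ T.root → p k = T.pathEstimate γ k / T.pathEstimate γ (T.next k)) (k : V) :
    T.reachProb p k = γ k / T.pathEstimate γ k := by
  induction k using branch_induction (T := T) with
  | branches k ih =>
    by_cases hk : T.IsLeaf k
    · rw [reachProb_leaf p hk, pathEstimate_leaf γ hk, div_self (h.leaf_pos k hk).ne']
    · rw [← sub_right_inj (a := 1), one_sub_reachProb p hk, h.mincEquation hk]
      refine Finset.prod_congr rfl fun j hj => ?_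
      have hj := mem_branches.1 hj
      rw [ih j hj, hp j hj.1, hj.2, mul_comm, div_mul_div_cancel₀ (h.pathEstimate_pos j).ne']

theorem mul_reachProb_lt_one (h : T.Regular γ)
    (hp : ∀ k, k ≠ T.root → p k = T.pathEstimate γ k / T.pathEstimate γ (T.next k))
    (hk : k ≠ T.root) : p k * T.reachProb p k < 1 := by
  have hnext : ¬ T.IsLeaf (T.next k) := not_isLeaf_iff.2 ⟨k, isBranch_next hk⟩
  rw [h.reachProb_eq hp, hp k hk, mul_comm, div_mul_div_cancel₀ (h.pathEstimate_pos k).ne',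
    div_lt_one (h.pathEstimate_pos _)]
  exact ((h.solvable _ hnext).lt k (mem_branches.2 (isBranch_next hk))).trans
    (h.lt_pathEstimate hnext)

theorem pathProb_eq (h : T.Regular γ)
    (hp : ∀ k, k ≠ T.root → p k = T.pathEstimate γ k / T.pathEstimate γ (T.next k)) (k : V) :
    T.pathProb p k = T.pathEstimate γ k / T.pathEstimate γ T.root := by
  induction k using root_induction (T := T) with
  | root => rw [pathProb_root, div_self (h.pathEstimate_pos _).ne']
  | next k hk ih =>
    rw [pathProb_eq_mul p hk, ih, hp k hk, div_mul_div_cancel₀ (h.pathEstimate_pos _).ne']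

theorem pathEstimate_eq (h : T.Regular γ) (hp : ∀ k, 0 < p k ∧ p k ≤ 1) {κ : ℝ} (hκ : 0 < κ)
    (hγ : ∀ k, γ k = κ * (T.pathProb p k * T.reachProb p k)) (k : V) :
    T.pathEstimate γ k = κ * T.pathProb p k := by
  by_cases hk : T.IsLeaf k
  · rw [pathEstimate_leaf γ hk, hγ, reachProb_leaf p hk, mul_one]
  have hpath : 0 < κ * T.pathProb p k := mul_pos hκ (pathProb_pos (fun k => (hp k).1) k)
  have hratio : ∀ j ∈ T.branches k, γ j / (κ * T.pathProb p k) = p j * T.reachProb p j := by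
    intro j hj
    rw [hγ, pathProb_eq_mul p (mem_branches.1 hj).1, (mem_branches.1 hj).2,
      div_eq_iff hpath.ne']
    ring
  have hreach : γ k / (κ * T.pathProb p k) = T.reachProb p k := by
    rw [hγ, ← mul_assoc, mul_div_cancel_left₀ _ hpath.ne']
  have hequation : 1 - γ k / (κ * T.pathProb p k) =
      ∏ j ∈ T.branches k, (1 - γ j / (κ * T.pathProb p k)) := by
    rw [hreach, one_sub_reachProb p hk]
    exact Finset.prod_congr rfl fun j hj => by rw [hratio j hj]
  have hlt : γ k < κ * T.pathProb p k := by
    rw [← div_lt_one hpath, ← sub_pos, hequation]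
    refine Finset.prod_pos fun j hj => sub_pos.2 ?_
    calc γ j / (κ * T.pathProb p k) < γ k / (κ * T.pathProb p k) := by
          gcongr; exact (h.solvable k hk).lt j hj
      _ = T.reachProb p k := hreach
      _ ≤ 1 := reachProb_le_one (fun k => ⟨(hp k).1.le, (hp k).2⟩) k
  rw [pathEstimate_inner γ hk]
  exact ((h.solvable k hk).eq_mincRoot hlt ((mincFun_eq_iff hpath.ne').2 hequation)).symm

theorem linkRate_pathEstimate (h : T.Regular γ) (hp : ∀ k, 0 < p k ∧ p k ≤ 1) {κ : ℝ} (hκ : 0 < κ)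
    (hγ : ∀ k, γ k = κ * (T.pathProb p k * T.reachProb p k)) (hk : k ≠ T.root) :
    T.linkRate (T.pathEstimate γ) k = p k := by
  have hpath := pathProb_pos (T := T) (fun k => (hp k).1) (T.next k)
  rw [linkRate_of_ne_root _ hk, h.pathEstimate_eq hp hκ hγ, h.pathEstimate_eq hp hκ hγ,
    pathProb_eq_mul p hk, div_eq_iff (mul_pos hκ hpath).ne']
  ring

variable {β : Type*} {l : Filter β} {u : β → V → ℝ}

theorem tendsto_pathEstimate (h : T.Regular γ) (hu : ∀ k, Tendsto (fun n => u n k) l (nhds (γ k)))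
    (k : V) : Tendsto (fun n => T.pathEstimate (u n) k) l (nhds (T.pathEstimate γ k)) := by
  by_cases hk : T.IsLeaf k
  · simpa only [pathEstimate_leaf _ hk] using hu k
  · simpa only [pathEstimate_inner _ hk] using
      (h.solvable k hk).tendsto_mincRoot (fun j _ => hu j) (hu k)

theorem tendsto_linkRate (h : T.Regular γ) (hu : ∀ k, Tendsto (fun n => u n k) l (nhds (γ k)))
    (k : V) : Tendsto (fun n => T.linkRate (T.pathEstimate (u n)) k) l
      (nhds (T.linkRate (T.pathEstimate γ) k)) := by
  by_cases hk : k = T.root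
  · simpa only [hk, linkRate_root] using h.tendsto_pathEstimate hu T.root
  · simp only [linkRate_of_ne_root _ hk]
    exact (h.tendsto_pathEstimate hu k).div (h.tendsto_pathEstimate hu _)
      (h.pathEstimate_pos _).ne'

end Regular

end Estimator

end LogicalTree

namespace LogicalTree

section Frequencies

variable {V X : Type*} {T : LogicalTree V} [Fintype X] {m : X → T.Leaf → Bool} {j k : V}

open Classical in
/-- The frequencies `γ` when the outcomes `x`, which mark the leaves `m x`, have the weights
`μ x`. -/
noncomputable def hitFreq (m : X → T.Leaf → Bool) (μ : X → ℝ) (k : V) : ℝ :=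
  ∑ x with T.Hit (m x) k, μ x

theorem hitFreq_pos {μ : X → ℝ} (hμ : ∀ x, 0 < μ x) (hm : ∃ x, T.Hit (m x) k) :
    0 < hitFreq m μ k := by
  obtain ⟨x, hx⟩ := hm
  exact Finset.sum_pos (fun x _ => hμ x) ⟨x, by simpa using hx⟩

theorem hitFreq_lt_hitFreq {μ : X → ℝ} (hμ : ∀ x, 0 < μ x) (hkj : T.OnPath k j)
    (hm : ∃ x, T.Hit (m x) k ∧ ¬ T.Hit (m x) j) : hitFreq m μ j < hitFreq m μ k := by
  classical
  obtain ⟨x, hxk, hxj⟩ := hm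
  exact Finset.sum_lt_sum_of_subset (Finset.monotone_filter_right _ fun x _ hx => hkj.hit hx)
    (by simpa using hxk) (by simpa using hxj) (hμ x) fun x _ _ => (hμ x).le

variable [Fintype V]

open Classical in
theorem hitFreq_lt_sum_branches {μ : X → ℝ} (hμ : ∀ x, 0 < μ x) (hk : ¬ T.IsLeaf k)
    (hm : ∃ x, ∀ j, T.Hit (m x) j) : hitFreq m μ k < ∑ j ∈ T.branches k, hitFreq m μ j := by
  have hswap : ∑ j ∈ T.branches k, hitFreq m μ j =
      ∑ x with T.Hit (m x) k, ((T.branches k).filter fun j => T.Hit (m x) j).card • μ x := by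
    simp only [hitFreq, ← Finset.sum_const]
    refine Finset.sum_comm' fun j x => ?_
    simp only [Finset.mem_filter, Finset.mem_univ, true_and]
    exact ⟨fun h => ⟨h, (mem_branches.1 h.1).onPath.hit h.2⟩, And.left⟩
  obtain ⟨x, hx⟩ := hm
  rw [hswap]
  refine Finset.sum_lt_sum (fun x hx => ?_) ⟨x, by simpa using hx k, ?_⟩
  · obtain ⟨j, hj⟩ := (hit_iff_exists_branches hk).1 (Finset.mem_filter.1 hx).2
    exact le_smul_of_one_le_left (hμ x).le (Finset.card_pos.2 ⟨j, Finset.mem_filter.2 hj⟩)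
  · rw [Finset.filter_true_of_mem fun j _ => hx j]
    exact lt_smul_of_one_lt_left (hμ x)
      (Finset.one_lt_card_iff_nontrivial.2 (branches_nontrivial hk))

theorem regular_hitFreq {μ : X → ℝ} (hμ : ∀ x, 0 < μ x) (hall : ∃ x, ∀ k, T.Hit (m x) k)
    (hbranch : ∀ j k, T.IsBranch j k → ∃ x, T.Hit (m x) k ∧ ¬ T.Hit (m x) j) :
    T.Regular (hitFreq m μ) where
  leaf_pos k _ := hitFreq_pos hμ (hall.imp fun _ hx => hx k)
  solvable k hk :=
    { nontrivial := branches_nontrivial hk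
      pos := fun j _ => hitFreq_pos hμ (hall.imp fun _ hx => hx j)
      lt := fun j hj => hitFreq_lt_hitFreq hμ (mem_branches.1 hj).onPath
        (hbranch j k (mem_branches.1 hj))
      lt_sum := hitFreq_lt_sum_branches hμ hk hall }

open Classical in
theorem freq_eq_hitFreq {c : (T.Leaf → Bool) → ℕ} {N : X → ℕ}
    (hc : ∀ y, c y = ∑ x with m x = y, N x) (k : V) :
    T.freq c k = hitFreq m (fun x => (N x : ℝ) / ∑ x, (N x : ℝ)) k := by
  have hsum : ∀ P : (T.Leaf → Bool) → Prop,
      ∑ y with P y, (c y : ℝ) = ∑ x with P (m x), (N x : ℝ) := fun P => by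
    simp only [hc, Nat.cast_sum]
    simpa using Finset.sum_fiberwise_eq_sum_filter Finset.univ (Finset.univ.filter P) m
      fun x => (N x : ℝ)
  have hhit := hsum fun y => T.Hit y k
  have htotal := hsum fun _ => True
  simp only [Finset.filter_true] at htotal
  rw [hitFreq, ← Finset.sum_div, ← hhit, ← htotal, Finset.sum_filter, freq]
  congr!

end Frequencies

end LogicalTree

namespace CodedTree

section Outcomes

variable {U W : Type*} (G : CodedTree U W)

open Classical in
/-- The link at a node of the upper tree, in the direction of the receivers. -/
noncomputable def upLink (k : U) : G.Link := if h : k = G.C then G.linkCD else G.above ⟨k, h⟩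

open Classical in
/-- The link at a node of the lower tree, in the direction of the sources. -/
noncomputable def downLink (k : W) : G.Link := if h : k = G.D then G.linkCD else G.below ⟨k, h⟩

/-- The outcome of an experiment in which exactly the links with `w e = true` work. -/
noncomputable def outcome (w : G.Link → Bool) : G.Outcome := ⟨G.observation w, w, rfl⟩

variable {G} {w : G.Link → Bool} {x : G.Outcome} {r : G.Receiver} {s : G.Source}

open Classical in
/-- The outcome of the reduced reverse multicast tree: the sources whose probes get through to some
receiver. -/
noncomputable def sourceMarks (x : G.Outcome) (s : G.Source) : Bool := decide (∃ r, x.1 r s)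

open Classical in
/-- The outcome of the reduced multicast tree: the receivers that get a nonzero packet. -/
noncomputable def receiverMarks (x : G.Outcome) (r : G.Receiver) : Bool := decide (∃ s, x.1 r s)

theorem upLink_C : G.upLink G.C = G.linkCD := dif_pos rfl

theorem downLink_D : G.downLink G.D = G.linkCD := dif_pos rfl

theorem upLink_of_ne {k : U} (h : k ≠ G.C) : G.upLink k = G.above ⟨k, h⟩ := dif_neg h

theorem downLink_of_ne {k : W} (h : k ≠ G.D) : G.downLink k = G.below ⟨k, h⟩ := dif_neg h

theorem upLink_injective : G.upLink.Injective := by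
  intro j k h
  by_cases hj : j = G.C <;> by_cases hk : k = G.C <;> simp_all [upLink]

theorem downLink_injective : G.downLink.Injective := by
  intro j k h
  by_cases hj : j = G.D <;> by_cases hk : k = G.D <;> simp_all [downLink]

theorem upLink_ne_downLink {j : U} (hj : j ≠ G.C) (k : W) : G.upLink j ≠ G.downLink k := by
  by_cases hk : k = G.D <;> simp [upLink, downLink, hj, hk]

theorem downLink_ne_upLink {j : W} (hj : j ≠ G.D) (k : U) : G.downLink j ≠ G.upLink k := by
  by_cases hk : k = G.C <;> simp [upLink, downLink, hj, hk]

theorem arrives_up {u v : U} (h : G.up.OnPath u v) (hc : G.up.Conn (w ∘ G.upLink) u v) :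
    G.Arrives w (Sum.inl v) (Sum.inl u) := by
  induction v using LogicalTree.root_induction (T := G.up) with
  | root => exact h.eq_root ▸ Relation.ReflTransGen.refl
  | next v hv ih =>
    rcases LogicalTree.onPath_iff_eq_or.1 h with rfl | hnext
    · exact Relation.ReflTransGen.refl
    · have hbranch := LogicalTree.isBranch_next hv
      obtain ⟨hc, hw⟩ := (LogicalTree.conn_trans_iff hnext hbranch.onPath).1 hc
      rw [hbranch.conn_iff, Function.comp_apply, upLink_of_ne hv] at hw
      exact Relation.ReflTransGen.head ⟨G.above ⟨v, hv⟩, hw, rfl, rfl⟩ (ih hnext hc)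

theorem arrives_down (hw : w G.linkCD) {v : W} (hc : G.down.Conn (w ∘ G.downLink) G.D v) :
    G.Arrives w (Sum.inl G.C) (Sum.inr v) := by
  induction v using LogicalTree.root_induction (T := G.down) with
  | root => exact Relation.ReflTransGen.single ⟨G.linkCD, hw, rfl, rfl⟩
  | next v hv ih =>
    obtain ⟨hv', hc⟩ := (LogicalTree.conn_root_iff hv).1 hc
    rw [Function.comp_apply, downLink_of_ne hv] at hv'
    exact (ih hc).tail ⟨G.below ⟨v, hv⟩, hv', rfl, rfl⟩

theorem Arrives.conn {u : U} {v : U ⊕ W} (h : G.Arrives w (Sum.inl u) v) :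
    Sum.elim (fun k => G.up.OnPath k u ∧ G.up.Conn (w ∘ G.upLink) k u)
      (fun k => G.up.Conn (w ∘ G.upLink) G.C u ∧ w G.linkCD ∧
        G.down.Conn (w ∘ G.downLink) G.D k) v := by
  induction h with
  | refl => exact ⟨G.up.onPath_refl u, LogicalTree.conn_self _ u⟩
  | tail _ h ih =>
    obtain ⟨e, he, rfl, rfl⟩ := h
    rcases e with ⟨k, hk⟩ | _ | ⟨k, hk⟩
    · have hbranch := LogicalTree.isBranch_next hk
      refine ⟨hbranch.onPath.trans ih.1, (hbranch.conn_iff_of_onPath ih.1).2 ⟨?_, ih.2⟩⟩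
      rwa [Function.comp_apply, upLink_of_ne hk]
    · exact ⟨ih.2, he, LogicalTree.conn_self _ _⟩
    · refine ⟨ih.1, ih.2.1, (LogicalTree.conn_root_iff hk).2 ⟨?_, ih.2.2⟩⟩
      rwa [Function.comp_apply, downLink_of_ne hk]

theorem observation_iff : G.observation w r s ↔ G.up.Conn (w ∘ G.upLink) G.C s ∧ w G.linkCD ∧
    G.down.Conn (w ∘ G.downLink) G.D r := by
  simp only [observation, decide_eq_true_iff]
  exact ⟨fun h => h.conn, fun ⟨hup, hCD, hdown⟩ =>
    (arrives_up (G.up.onPath_root _) hup).trans (arrives_down hCD hdown)⟩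

theorem sourceMarks_iff : sourceMarks x s ↔ ∃ r, x.1 r s := by
  simp only [sourceMarks, decide_eq_true_iff]

theorem receiverMarks_iff : receiverMarks x r ↔ ∃ s, x.1 r s := by
  simp only [receiverMarks, decide_eq_true_iff]

theorem hit_sourceMarks_C : G.up.Hit (sourceMarks x) G.C ↔ ∃ r s, x.1 r s := by
  simp only [LogicalTree.Hit, sourceMarks_iff, G.up.onPath_root, true_and]
  exact exists_comm

theorem hit_receiverMarks_D : G.down.Hit (receiverMarks x) G.D ↔ ∃ r s, x.1 r s := by
  simp only [LogicalTree.Hit, receiverMarks_iff, G.down.onPath_root, true_and]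

theorem reaches_C : G.up.Reaches (w ∘ G.upLink) G.C ↔
    ∃ s : G.Source, G.up.Conn (w ∘ G.upLink) G.C s := by
  simp only [LogicalTree.Reaches, G.up.onPath_root, true_and]

theorem reaches_D : G.down.Reaches (w ∘ G.downLink) G.D ↔
    ∃ r : G.Receiver, G.down.Conn (w ∘ G.downLink) G.D r := by
  simp only [LogicalTree.Reaches, G.down.onPath_root, true_and]

theorem hit_sourceMarks_outcome {k : U} : G.up.Hit (sourceMarks (G.outcome w)) k ↔
    (G.up.Conn (w ∘ G.upLink) G.C k ∧ G.up.Reaches (w ∘ G.upLink) k) ∧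
      w G.linkCD ∧ G.down.Reaches (w ∘ G.downLink) G.D := by
  rw [reaches_D]
  simp only [LogicalTree.Hit, LogicalTree.Reaches, sourceMarks_iff, outcome, observation_iff]
  constructor
  · rintro ⟨s, hs, r, hup, hCD, hdown⟩
    obtain ⟨hk, hs'⟩ := (LogicalTree.conn_trans_iff (G.up.onPath_root k) hs).1 hup
    exact ⟨⟨hk, s, hs, hs'⟩, hCD, r, hdown⟩
  · rintro ⟨⟨hk, s, hs, hs'⟩, hCD, r, hdown⟩
    exact ⟨s, hs, r, (LogicalTree.conn_trans_iff (G.up.onPath_root k) hs).2 ⟨hk, hs'⟩, hCD, hdown⟩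

theorem hit_receiverMarks_outcome {k : W} : G.down.Hit (receiverMarks (G.outcome w)) k ↔
    G.up.Reaches (w ∘ G.upLink) G.C ∧ w G.linkCD ∧
      (G.down.Conn (w ∘ G.downLink) G.D k ∧ G.down.Reaches (w ∘ G.downLink) k) := by
  rw [reaches_C]
  simp only [LogicalTree.Hit, LogicalTree.Reaches, receiverMarks_iff, outcome, observation_iff]
  constructor
  · rintro ⟨r, hr, s, hup, hCD, hdown⟩
    obtain ⟨hk, hr'⟩ := (LogicalTree.conn_trans_iff (G.down.onPath_root k) hr).1 hdown
    exact ⟨⟨s, hup⟩, hCD, hk, r, hr, hr'⟩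
  · rintro ⟨⟨s, hup⟩, hCD, hk, r, hr, hr'⟩
    exact ⟨r, hr, s, hup, hCD, (LogicalTree.conn_trans_iff (G.down.onPath_root k) hr).2 ⟨hk, hr'⟩⟩

-- A possible nonzero outcome is a rectangle: `x r s` holds exactly when `s` and `r` are marked.
theorem observation_eq_iff (hx : ∃ r s, x.1 r s) : G.observation w = x.1 ↔
    G.up.Pattern (sourceMarks x) (w ∘ G.upLink) G.C ∧ w G.linkCD ∧
      G.down.Pattern (receiverMarks x) (w ∘ G.downLink) G.D := by
  simp only [LogicalTree.Pattern, sourceMarks_iff, receiverMarks_iff, G.up.onPath_root,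
    G.down.onPath_root, true_implies]
  constructor
  · intro h
    obtain ⟨r, s, hrs⟩ := hx
    simp only [← h, observation_iff] at hrs ⊢
    exact ⟨fun s' => ⟨fun hs' => ⟨r, hs', hrs.2⟩, fun ⟨_, h⟩ => h.1⟩, hrs.2.1,
      fun r' => ⟨fun hr' => ⟨s, hrs.1, hrs.2.1, hr'⟩, fun ⟨_, h⟩ => h.2.2⟩⟩
  · rintro ⟨hup, hCD, hdown⟩
    obtain ⟨_, w', rfl⟩ := x
    funext r s
    rw [Bool.eq_iff_iff, observation_iff, hup, hdown]
    simp only [observation_iff]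
    exact ⟨fun ⟨⟨_, hs⟩, _, ⟨_, hr⟩⟩ => ⟨hs.1, hr.2⟩, fun h => ⟨⟨r, h⟩, hCD, ⟨s, h⟩⟩⟩

theorem observation_eq_iff_of_zero (hx : ¬ ∃ r s, x.1 r s) : G.observation w = x.1 ↔
    ¬ (G.up.Reaches (w ∘ G.upLink) G.C ∧ w G.linkCD ∧
      G.down.Reaches (w ∘ G.downLink) G.D) := by
  rw [reaches_C, reaches_D]
  simp only [not_exists] at hx
  constructor
  · rintro h ⟨⟨s, hs⟩, hCD, r, hr⟩
    exact hx r s (h ▸ observation_iff.2 ⟨hs, hCD, hr⟩)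
  · intro h
    funext r s
    rw [Bool.eq_iff_iff, observation_iff]
    exact iff_of_false (fun ⟨hs, hCD, hr⟩ => h ⟨⟨s, hs⟩, hCD, r, hr⟩) (hx r s)

theorem exists_outcome_zero (G : CodedTree U W) : ∃ x : G.Outcome, ¬ ∃ r s, x.1 r s :=
  ⟨G.outcome fun _ => false, fun ⟨_, _, h⟩ => Bool.false_ne_true (observation_iff.1 h).2.1⟩

variable [Finite U] [Finite W]

theorem exists_hit_sourceMarks (G : CodedTree U W) :
    ∃ x : G.Outcome, ∀ k, G.up.Hit (sourceMarks x) k :=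
  ⟨G.outcome fun _ => true, fun k => hit_sourceMarks_outcome.2 ⟨⟨fun _ _ _ _ => rfl,
    LogicalTree.reaches_of_forall (fun _ => rfl) k⟩, rfl,
    LogicalTree.reaches_of_forall (fun _ => rfl) _⟩⟩

theorem exists_hit_receiverMarks (G : CodedTree U W) :
    ∃ x : G.Outcome, ∀ k, G.down.Hit (receiverMarks x) k :=
  ⟨G.outcome fun _ => true, fun k => hit_receiverMarks_outcome.2
    ⟨LogicalTree.reaches_of_forall (fun _ => rfl) _, rfl, fun _ _ _ _ => rfl,
      LogicalTree.reaches_of_forall (fun _ => rfl) k⟩⟩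

theorem exists_hit_sourceMarks_not_branch {j k : U} (h : G.up.IsBranch j k) :
    ∃ x : G.Outcome, G.up.Hit (sourceMarks x) k ∧ ¬ G.up.Hit (sourceMarks x) j := by
  classical
  let w : G.Link → Bool := fun e => decide (e ≠ G.upLink j)
  have hup : ∀ i, (w ∘ G.upLink) i ↔ i ≠ j := by simp [w, upLink_injective.eq_iff]
  have hdown : ∀ i, (w ∘ G.downLink) i := by simp [w, (upLink_ne_downLink h.1 _).symm]
  refine ⟨G.outcome w, hit_sourceMarks_outcome.2 ⟨⟨h.conn_root hup, h.reaches_sibling hup⟩, ?_,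
    LogicalTree.reaches_of_forall hdown _⟩, fun hj => ?_⟩
  · exact downLink_D (G := G) ▸ hdown G.D
  · exact h.not_conn_root hup (hit_sourceMarks_outcome.1 hj).1.1

theorem exists_hit_receiverMarks_not_branch {j k : W} (h : G.down.IsBranch j k) :
    ∃ x : G.Outcome, G.down.Hit (receiverMarks x) k ∧ ¬ G.down.Hit (receiverMarks x) j := by
  classical
  let w : G.Link → Bool := fun e => decide (e ≠ G.downLink j)
  have hdown : ∀ i, (w ∘ G.downLink) i ↔ i ≠ j := by simp [w, downLink_injective.eq_iff]
  have hup : ∀ i, (w ∘ G.upLink) i := by simp [w, (downLink_ne_upLink h.1 _).symm]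
  refine ⟨G.outcome w, hit_receiverMarks_outcome.2 ⟨LogicalTree.reaches_of_forall hup _, ?_,
    h.conn_root hdown, h.reaches_sibling hdown⟩, fun hj => ?_⟩
  · exact upLink_C (G := G) ▸ hup G.C
  · exact h.not_conn_root hdown (hit_receiverMarks_outcome.1 hj).2.2.1

end Outcomes

end CodedTree

namespace CodedTree

section Probabilities

variable {U W : Type*} [Fintype U] [Fintype W] {G : CodedTree U W} {α : G.Link → ℝ}
  {x : G.Outcome}

open Classical in
theorem prob_eq_linkProb (α : G.Link → ℝ) (x : G.Outcome) :
    G.prob α x = linkProb α fun w => G.observation w = x.1 := by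
  rw [linkProb_eq_sum, Finset.sum_filter, prob]
  congr!

open Classical in
theorem prob_nonneg (hα : α ∈ G.rates) (x : G.Outcome) : 0 ≤ G.prob α x :=
  prob_eq_linkProb α x ▸ linkProb_nonneg (fun e => ⟨(hα e).1.le, (hα e).2⟩) _

open Classical in
theorem prob_pos (hα : ∀ e, 0 < α e ∧ α e < 1) (x : G.Outcome) : 0 < G.prob α x :=
  prob_eq_linkProb α x ▸ linkProb_pos hα x.2.choose_spec

open Classical in
theorem sum_prob_filter (α : G.Link → ℝ) (P : G.Outcome → Prop) :
    ∑ x with P x, G.prob α x = linkProb α fun w => P (G.outcome w) := by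
  simp only [prob_eq_linkProb, linkProb]
  rw [← Finset.sum_fiberwise_of_maps_to (g := G.outcome) (t := {x | P x})
    fun w hw => by simpa using hw]
  refine Finset.sum_congr rfl fun x hx => Finset.sum_congr ?_ fun _ _ => rfl
  ext w
  simp only [Finset.mem_filter, Finset.mem_univ, true_and] at hx ⊢
  exact ⟨fun h => have := Subtype.ext (a1 := G.outcome w) h; ⟨this ▸ hx, this⟩,
    fun h => congrArg Subtype.val h.2⟩

open Classical in
theorem sum_prob (α : G.Link → ℝ) : ∑ x, G.prob α x = 1 := by
  simpa [linkProb_true] using sum_prob_filter α fun _ => True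

open Classical in
theorem linkProb_up_and_linkCD_and_down (α : G.Link → ℝ) {A : (U → Bool) → Prop}
    {B : (W → Bool) → Prop} (hA : DependsOn A {k | k ≠ G.C}) (hB : DependsOn B {k | k ≠ G.D}) :
    linkProb α (fun w => A (w ∘ G.upLink) ∧ w G.linkCD ∧ B (w ∘ G.downLink)) =
      linkProb (α ∘ G.upLink) A * (α G.linkCD * linkProb (α ∘ G.downLink) B) := by
  have hup : DependsOn (fun w => A (w ∘ G.upLink)) (Set.range G.above) := fun w w' h =>
    hA fun k hk => by simpa [upLink_of_ne hk] using h _ ⟨⟨k, hk⟩, rfl⟩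
  have hdown : DependsOn (fun w => B (w ∘ G.downLink)) (Set.range G.below) := fun w w' h =>
    hB fun k hk => by simpa [downLink_of_ne hk] using h _ ⟨⟨k, hk⟩, rfl⟩
  have hCD : DependsOn (fun w : G.Link → Bool => (w G.linkCD : Prop)) {G.linkCD} :=
    fun _ _ h => by simp only [h _ rfl]
  have hrest : DependsOn (fun w => w G.linkCD ∧ B (w ∘ G.downLink))
      ({G.linkCD} ∪ Set.range G.below) := fun w w' h => congrArg₂ And
    (hCD fun e he => h e (Or.inl he)) (hdown fun e he => h e (Or.inr he))
  rw [linkProb_and α hup hrest, linkProb_and α hCD hdown, linkProb_comp upLink_injective,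
    linkProb_comp downLink_injective, linkProb_coordinate]
  all_goals simp [Set.disjoint_left]

open Classical in
theorem prob_of_nonzero (α : G.Link → ℝ) (hx : ∃ r s, x.1 r s) :
    G.prob α x = G.up.patternProb (α ∘ G.upLink) (sourceMarks x) G.C *
      (α G.linkCD * G.down.patternProb (α ∘ G.downLink) (receiverMarks x) G.D) := by
  simp only [prob_eq_linkProb, observation_eq_iff hx]
  exact linkProb_up_and_linkCD_and_down α
    ((LogicalTree.dependsOn_pattern _ _).mono fun _ => LogicalTree.ne_root_of_mem_beyond)
    ((LogicalTree.dependsOn_pattern _ _).mono fun _ => LogicalTree.ne_root_of_mem_beyond)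

open Classical in
theorem prob_of_zero (α : G.Link → ℝ) (hx : ¬ ∃ r s, x.1 r s) :
    G.prob α x = 1 - G.up.reachProb (α ∘ G.upLink) G.C *
      (α G.linkCD * G.down.reachProb (α ∘ G.downLink) G.D) := by
  simp only [prob_eq_linkProb, observation_eq_iff_of_zero hx]
  rw [linkProb_not, linkProb_up_and_linkCD_and_down α
    ((LogicalTree.dependsOn_reaches _).mono fun _ => LogicalTree.ne_root_of_mem_beyond)
    ((LogicalTree.dependsOn_reaches _).mono fun _ => LogicalTree.ne_root_of_mem_beyond)]
  rfl

end Probabilities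

end CodedTree

section RelativeFrequencies

variable {X : Type*} [Fintype X] {N : X → ℕ}

/-- The relative frequencies of the outcomes `x` in an experiment with counts `N x`. -/
noncomputable def relativeFreq (N : X → ℕ) (x : X) : ℝ := (N x : ℝ) / ∑ x, (N x : ℝ)

theorem relativeFreq_pos (hN : ∀ x, 0 < N x) (x : X) : 0 < relativeFreq N x :=
  div_pos (Nat.cast_pos.2 (hN x))
    (Finset.sum_pos (fun x _ => Nat.cast_pos.2 (hN x)) ⟨x, Finset.mem_univ x⟩)

theorem sum_relativeFreq (hN : ∃ x, 0 < N x) : ∑ x, relativeFreq N x = 1 := by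
  simp only [relativeFreq, ← Finset.sum_div]
  refine div_self (ne_of_gt ?_)
  exact_mod_cast Finset.sum_pos' (fun x _ => (N x).zero_le) (by simpa using hN)

theorem sum_mul_relativeFreq (N : X → ℕ) (x : X) :
    (∑ x, (N x : ℝ)) * relativeFreq N x = N x := by
  refine mul_div_cancel_of_imp' fun h => ?_
  exact (Finset.sum_eq_zero_iff_of_nonneg fun x _ => Nat.cast_nonneg _).1 h x (Finset.mem_univ x)

end RelativeFrequencies

namespace CodedTree

section Estimate

variable {U W : Type*} [Fintype U] [Fintype W] {G : CodedTree U W} {α : G.Link → ℝ}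
  {μ ν : G.Outcome → ℝ}

open Classical in
/-- The frequencies `γ^r` of the reduced reverse multicast tree when outcome `x` has the weight
`μ x`. -/
noncomputable def upFreq (μ : G.Outcome → ℝ) : U → ℝ := LogicalTree.hitFreq sourceMarks μ

open Classical in
/-- The frequencies `γ^m` of the reduced multicast tree when outcome `x` has the weight `μ x`. -/
noncomputable def downFreq (μ : G.Outcome → ℝ) : W → ℝ := LogicalTree.hitFreq receiverMarks μ

/-- The link rates that the algorithm computes when the outcomes `x` have the relative
frequencies `μ x`. -/
noncomputable def estimate (G : CodedTree U W) (μ : G.Outcome → ℝ) : G.Link → ℝ :=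
  Sum.elim (fun k => G.up.linkRate (G.up.pathEstimate (upFreq μ)) k)
    (Sum.elim
      (fun _ => G.up.pathEstimate (upFreq μ) G.C * G.down.pathEstimate (downFreq μ) G.D /
        downFreq μ G.D)
      (fun k => G.down.linkRate (G.down.pathEstimate (downFreq μ)) k))

theorem estimate_congr (hup : upFreq μ = upFreq ν) (hdown : downFreq μ = downFreq ν) :
    G.estimate μ = G.estimate ν := by
  simp only [estimate, hup, hdown]

theorem estimate_linkCD (μ : G.Outcome → ℝ) : G.estimate μ G.linkCD =
    G.up.pathEstimate (upFreq μ) G.C * G.down.pathEstimate (downFreq μ) G.D / downFreq μ G.D := rfl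

theorem estimate_upLink (μ : G.Outcome → ℝ) {k : U} (hk : k ≠ G.C) :
    (G.estimate μ ∘ G.upLink) k =
      G.up.pathEstimate (upFreq μ) k / G.up.pathEstimate (upFreq μ) (G.up.next k) := by
  rw [Function.comp_apply, upLink_of_ne hk, ← LogicalTree.linkRate_of_ne_root _ hk]
  rfl

theorem estimate_downLink (μ : G.Outcome → ℝ) {k : W} (hk : k ≠ G.D) :
    (G.estimate μ ∘ G.downLink) k =
      G.down.pathEstimate (downFreq μ) k / G.down.pathEstimate (downFreq μ) (G.down.next k) := by
  rw [Function.comp_apply, downLink_of_ne hk, ← LogicalTree.linkRate_of_ne_root _ hk]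
  rfl

theorem upFreq_C (μ : G.Outcome → ℝ) : upFreq μ G.C = downFreq μ G.D := by
  classical
  rw [upFreq, downFreq, LogicalTree.hitFreq, LogicalTree.hitFreq]
  congr! 2
  simp only [hit_sourceMarks_C, hit_receiverMarks_D]

theorem regular_upFreq (hμ : ∀ x, 0 < μ x) : G.up.Regular (upFreq μ) :=
  open Classical in LogicalTree.regular_hitFreq hμ G.exists_hit_sourceMarks
    fun _ _ => exists_hit_sourceMarks_not_branch

theorem regular_downFreq (hμ : ∀ x, 0 < μ x) : G.down.Regular (downFreq μ) :=
  open Classical in LogicalTree.regular_hitFreq hμ G.exists_hit_receiverMarks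
    fun _ _ => exists_hit_receiverMarks_not_branch

open Classical in
theorem isAlgorithmOutput_iff {N : G.Outcome → ℕ} (hN : ∀ x, 0 < N x) :
    G.IsAlgorithmOutput N α ↔ α = G.estimate (relativeFreq N) := by
  have hup : G.up.freq (G.reverseCount N) = upFreq (relativeFreq N) := funext
    (LogicalTree.freq_eq_hitFreq (m := sourceMarks) fun y => by
      simp only [reverseCount, Finset.sum_filter, funext_iff, Bool.eq_iff_iff (b := y _),
        sourceMarks_iff, Iff.comm])
  have hdown : G.down.freq (G.multicastCount N) = downFreq (relativeFreq N) := funext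
    (LogicalTree.freq_eq_hitFreq (m := receiverMarks) fun y => by
      simp only [multicastCount, Finset.sum_filter, funext_iff, Bool.eq_iff_iff (b := y _),
        receiverMarks_iff, Iff.comm])
  have hregUp := hup ▸ regular_upFreq (relativeFreq_pos hN)
  have hregDown := hdown ▸ regular_downFreq (relativeFreq_pos hN)
  simp only [IsAlgorithmOutput, hregUp.isMINC_iff, hregDown.isMINC_iff, hup, hdown]
  constructor
  · rintro ⟨_, _, _, _, ⟨rfl, rfl⟩, ⟨rfl, rfl⟩, hbelow, habove, hCD⟩
    funext e
    rcases e with k | _ | k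
    exacts [habove k, hCD, hbelow k]
  · rintro rfl
    exact ⟨_, _, _, _, ⟨rfl, rfl⟩, ⟨rfl, rfl⟩, fun _ => rfl, fun _ => rfl, rfl⟩

open Classical in
theorem upFreq_prob (α : G.Link → ℝ) (k : U) : upFreq (G.prob α) k =
    α G.linkCD * G.down.reachProb (α ∘ G.downLink) G.D *
      (G.up.pathProb (α ∘ G.upLink) k * G.up.reachProb (α ∘ G.upLink) k) := by
  rw [upFreq, LogicalTree.hitFreq, sum_prob_filter]
  simp only [hit_sourceMarks_outcome]
  refine (linkProb_up_and_linkCD_and_down α (LogicalTree.dependsOn_conn_root_and_reaches k)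
    ((LogicalTree.dependsOn_reaches _).mono fun _ => LogicalTree.ne_root_of_mem_beyond)).trans ?_
  rw [LogicalTree.linkProb_conn_and_reaches, mul_comm]
  rfl

open Classical in
theorem downFreq_prob (α : G.Link → ℝ) (k : W) : downFreq (G.prob α) k =
    α G.linkCD * G.up.reachProb (α ∘ G.upLink) G.C *
      (G.down.pathProb (α ∘ G.downLink) k * G.down.reachProb (α ∘ G.downLink) k) := by
  rw [downFreq, LogicalTree.hitFreq, sum_prob_filter]
  simp only [hit_receiverMarks_outcome]
  refine (linkProb_up_and_linkCD_and_down α ((LogicalTree.dependsOn_reaches _).mono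
    fun _ => LogicalTree.ne_root_of_mem_beyond)
    (LogicalTree.dependsOn_conn_root_and_reaches k)).trans ?_
  rw [LogicalTree.linkProb_conn_and_reaches, ← mul_assoc, mul_comm (linkProb _ _)]
  rfl

theorem estimate_prob (hα : α ∈ G.rates) (hprob : ∀ x, 0 < G.prob α x) :
    G.estimate (G.prob α) = α := by
  have hregUp := regular_upFreq hprob
  have hregDown := regular_downFreq hprob
  have hCD : 0 < α G.linkCD := (hα _).1
  have hreachUp : 0 < G.up.reachProb (α ∘ G.upLink) G.C :=
    LogicalTree.reachProb_pos (fun k => hα _) _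
  have hreachDown : 0 < G.down.reachProb (α ∘ G.downLink) G.D :=
    LogicalTree.reachProb_pos (fun k => hα _) _
  funext e
  rcases e with ⟨k, hk⟩ | _ | ⟨k, hk⟩
  · refine (hregUp.linkRate_pathEstimate (fun k => hα _) (mul_pos hCD hreachDown)
      (upFreq_prob α) hk).trans ?_
    rw [upLink_of_ne hk]
  · refine (estimate_linkCD _).trans ?_
    rw [hregUp.pathEstimate_eq (fun k => hα _) (mul_pos hCD hreachDown) (upFreq_prob α),
      hregDown.pathEstimate_eq (fun k => hα _) (mul_pos hCD hreachUp) (downFreq_prob α),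
      downFreq_prob]
    simp only [LogicalTree.pathProb_root]
    field_simp
  · refine (hregDown.linkRate_pathEstimate (fun k => hα _) (mul_pos hCD hreachUp)
      (downFreq_prob α) hk).trans ?_
    rw [downLink_of_ne hk]

theorem upFreq_prob_estimate (hμ : ∀ x, 0 < μ x) :
    upFreq (G.prob (G.estimate μ)) = upFreq μ := by
  have hregUp := regular_upFreq hμ
  have hregDown := regular_downFreq hμ
  funext k
  rw [upFreq_prob, hregUp.pathProb_eq fun _ => estimate_upLink μ,
    hregUp.reachProb_eq fun _ => estimate_upLink μ,
    hregDown.reachProb_eq fun _ => estimate_downLink μ, estimate_linkCD]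
  have := (hregUp.pathEstimate_pos k).ne'
  have := (hregUp.pathEstimate_pos G.C).ne'
  have := (hregDown.pathEstimate_pos G.D).ne'
  have := (hregDown.freq_pos G.D).ne'
  field_simp

theorem downFreq_prob_estimate (hμ : ∀ x, 0 < μ x) :
    downFreq (G.prob (G.estimate μ)) = downFreq μ := by
  have hregUp := regular_upFreq hμ
  have hregDown := regular_downFreq hμ
  funext k
  rw [downFreq_prob, hregDown.pathProb_eq fun _ => estimate_downLink μ,
    hregDown.reachProb_eq fun _ => estimate_downLink μ,
    hregUp.reachProb_eq fun _ => estimate_upLink μ, estimate_linkCD, upFreq_C]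
  have := (hregDown.pathEstimate_pos k).ne'
  have := (hregUp.pathEstimate_pos G.C).ne'
  have := (hregDown.pathEstimate_pos G.D).ne'
  have := (hregDown.freq_pos G.D).ne'
  field_simp

theorem tendsto_estimate {β : Type*} {l : Filter β} {u : β → G.Outcome → ℝ} (hμ : ∀ x, 0 < μ x)
    (hu : ∀ x, Tendsto (fun n => u n x) l (nhds (μ x))) (e : G.Link) :
    Tendsto (fun n => G.estimate (u n) e) l (nhds (G.estimate μ e)) := by
  have hregUp := regular_upFreq hμ
  have hregDown := regular_downFreq hμ
  have hup : ∀ k, Tendsto (fun n => upFreq (u n) k) l (nhds (upFreq μ k)) :=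
    fun k => tendsto_finsetSum _ fun x _ => hu x
  have hdown : ∀ k, Tendsto (fun n => downFreq (u n) k) l (nhds (downFreq μ k)) :=
    fun k => tendsto_finsetSum _ fun x _ => hu x
  rcases e with k | _ | k
  · exact hregUp.tendsto_linkRate hup k
  · exact ((hregUp.tendsto_pathEstimate hup G.C).mul (hregDown.tendsto_pathEstimate hdown G.D)).div
      (hdown G.D) (hregDown.freq_pos G.D).ne'
  · exact hregDown.tendsto_linkRate hdown k

end Estimate

end CodedTree

theorem sum_mul_log_lt_sum_mul_log {X : Type*} [Fintype X] {p q : X → ℝ} (hp : ∀ x, 0 ≤ p x)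
    (hq : ∀ x, 0 < q x) (hsum : ∑ x, p x = ∑ x, q x) (hne : p ≠ q) :
    ∑ x, p x * Real.log (q x) < ∑ x, p x * Real.log (p x) := by
  have hkl (x : X) : q x * InformationTheory.klFun (p x / q x) =
      p x * Real.log (p x) - p x * Real.log (q x) + (q x - p x) := by
    rcases eq_or_ne (p x) 0 with h0 | h0
    · simp [h0, InformationTheory.klFun_apply]
    · rw [InformationTheory.klFun_apply, Real.log_div h0 (hq x).ne']
      have := (hq x).ne'
      field_simp
      ring
  have hratio (x : X) : 0 ≤ p x / q x := div_nonneg (hp x) (hq x).le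
  have hpos : 0 < ∑ x, q x * InformationTheory.klFun (p x / q x) := by
    obtain ⟨x, hx⟩ := Function.ne_iff.1 hne
    refine Finset.sum_pos'
      (fun x _ => mul_nonneg (hq x).le (InformationTheory.klFun_nonneg (hratio x)))
      ⟨x, Finset.mem_univ x, mul_pos (hq x) ?_⟩
    refine (InformationTheory.klFun_nonneg (hratio x)).lt_of_ne' ?_
    rwa [Ne, InformationTheory.klFun_eq_zero_iff (hratio x), div_eq_one_iff_eq (hq x).ne']
  simp only [hkl, Finset.sum_add_distrib, Finset.sum_sub_distrib, hsum] at hpos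
  linarith

namespace LogicalTree

section LogLikelihood

variable {V X : Type*} [Fintype X] {T : LogicalTree V} {m : X → T.Leaf → Bool} {p : V → ℝ}
  {k : V}

open Classical in
theorem hitFreq_sub_hitFreq {j : V} (hkj : T.OnPath k j) (m : X → T.Leaf → Bool) (μ : X → ℝ) :
    hitFreq m μ k - hitFreq m μ j = ∑ x with T.Hit (m x) k ∧ ¬ T.Hit (m x) j, μ x := by
  rw [hitFreq, hitFreq, sub_eq_iff_eq_add', ← Finset.sum_filter_add_sum_filter_not
    (Finset.univ.filter fun x => T.Hit (m x) k) fun x => T.Hit (m x) j, Finset.filter_filter,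
    Finset.filter_filter]
  simp only [and_iff_right_of_imp hkj.hit]

variable [Fintype V]

/-- The log-likelihood per experiment of the link rates `p` beyond `k` when the frequencies are
`γ` and only the experiments in which some leaf beyond `k` is marked are taken into account. -/
noncomputable def logLikelihood (T : LogicalTree V) (γ p : V → ℝ) (k : V) : ℝ :=
  ∑ j ∈ T.beyond k,
    (γ j * Real.log (p j) + (γ (T.next j) - γ j) * Real.log (1 - p j * T.reachProb p j))

theorem patternProb_pos {y : T.Leaf → Bool} (hp : ∀ j, 0 < p j)
    (hlt : ∀ j, j ≠ T.root → p j * T.reachProb p j < 1) (hy : T.Hit y k) :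
    0 < T.patternProb p y k := by
  rw [patternProb_of_hit p hy]
  refine Finset.prod_pos fun j hj => ?_
  split_ifs
  exacts [hp j, sub_pos.2 (hlt j (ne_root_of_mem_beyond hj)), one_pos]

open Classical in
theorem sum_mul_log_patternProb {μ : X → ℝ}
    (hprob : ∀ x, T.Hit (m x) k → T.patternProb p (m x) k ≠ 0) :
    ∑ x with T.Hit (m x) k, μ x * Real.log (T.patternProb p (m x) k) =
      T.logLikelihood (hitFreq m μ) p k := by
  have hlog (x : X) (hx : T.Hit (m x) k) : Real.log (T.patternProb p (m x) k) =
      ∑ j ∈ T.beyond k, if T.Hit (m x) j then Real.log (p j)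
        else if T.Hit (m x) (T.next j) then Real.log (1 - p j * T.reachProb p j) else 0 := by
    have hfactor := hprob x hx
    rw [patternProb_of_hit p hx] at hfactor ⊢
    rw [Real.log_prod (Finset.prod_ne_zero_iff.1 hfactor)]
    exact Finset.sum_congr rfl fun j _ => by split_ifs <;> simp
  calc ∑ x with T.Hit (m x) k, μ x * Real.log (T.patternProb p (m x) k)
    _ = ∑ j ∈ T.beyond k, ∑ x with T.Hit (m x) k, μ x * (if T.Hit (m x) j then Real.log (p j)
        else if T.Hit (m x) (T.next j) then Real.log (1 - p j * T.reachProb p j) else 0) := by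
      rw [Finset.sum_comm]
      refine Finset.sum_congr rfl fun x hx => ?_
      rw [hlog x (Finset.mem_filter.1 hx).2, Finset.mul_sum]
    _ = T.logLikelihood (hitFreq m μ) p k := by
      refine Finset.sum_congr rfl fun j hj => ?_
      have hk_next := onPath_next_of_mem_beyond hj
      have hnext_j := (isBranch_next (ne_root_of_mem_beyond hj)).onPath
      rw [hitFreq_sub_hitFreq hnext_j, hitFreq,
        Finset.sum_mul, Finset.sum_mul, Finset.sum_filter, Finset.sum_filter, Finset.sum_filter,
        ← Finset.sum_add_distrib]
      refine Finset.sum_congr rfl fun x _ => ?_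
      by_cases hx : T.Hit (m x) j
      · simp [hx, hnext_j.hit hx, hk_next.hit (hnext_j.hit hx)]
      · by_cases hx_next : T.Hit (m x) (T.next j)
        · simp [hx, hx_next, hk_next.hit hx_next]
        · simp [hx, hx_next]

end LogLikelihood

end LogicalTree

namespace CodedTree

section Likelihood

variable {U W : Type*} [Fintype U] [Fintype W] {G : CodedTree U W} {α β : G.Link → ℝ}
  {μ ν : G.Outcome → ℝ} {N : G.Outcome → ℕ}

theorem estimate_pos (hμ : ∀ x, 0 < μ x) (e : G.Link) : 0 < G.estimate μ e := by
  have hup := (regular_upFreq hμ).pathEstimate_pos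
  have hdown := (regular_downFreq hμ).pathEstimate_pos
  rcases e with ⟨k, hk⟩ | _ | ⟨k, hk⟩
  · have h := estimate_upLink μ hk
    rw [Function.comp_apply, upLink_of_ne hk] at h
    exact h ▸ div_pos (hup _) (hup _)
  · exact div_pos (mul_pos (hup _) (hdown _)) ((regular_downFreq hμ).freq_pos _)
  · have h := estimate_downLink μ hk
    rw [Function.comp_apply, downLink_of_ne hk] at h
    exact h ▸ div_pos (hdown _) (hdown _)

open Classical in
theorem sum_sub_upFreq_C (μ : G.Outcome → ℝ) :
    ∑ x, μ x - upFreq μ G.C = ∑ x with ¬ ∃ r s, x.1 r s, μ x := by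
  rw [sub_eq_iff_eq_add', upFreq, LogicalTree.hitFreq, ← Finset.sum_filter_add_sum_filter_not _
    fun x : G.Outcome => ∃ r s, x.1 r s]
  simp only [hit_sourceMarks_C]

open Classical in
theorem upFreq_C_lt_sum (hμ : ∀ x, 0 < μ x) : upFreq μ G.C < ∑ x, μ x := by
  obtain ⟨x, hx⟩ := G.exists_outcome_zero
  rw [← sub_pos, sum_sub_upFreq_C]
  exact Finset.sum_pos (fun x _ => hμ x) ⟨x, by simpa using hx⟩

open Classical in
theorem prob_estimate_pos (hμ : ∀ x, 0 < μ x) (hsum : ∑ x, μ x = 1) (x : G.Outcome) :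
    0 < G.prob (G.estimate μ) x := by
  by_cases hx : ∃ r s, x.1 r s
  · rw [prob_of_nonzero _ hx]
    exact mul_pos
      (LogicalTree.patternProb_pos (fun _ => estimate_pos hμ _)
        (fun _ => (regular_upFreq hμ).mul_reachProb_lt_one fun _ => estimate_upLink μ)
        (hit_sourceMarks_C.2 hx))
      (mul_pos (estimate_pos hμ _) (LogicalTree.patternProb_pos (fun _ => estimate_pos hμ _)
        (fun _ => (regular_downFreq hμ).mul_reachProb_lt_one fun _ => estimate_downLink μ)
        (hit_receiverMarks_D.2 hx)))
  · rw [prob_of_zero _ hx, sub_pos]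
    calc _ = upFreq (G.prob (G.estimate μ)) G.C := by
          rw [upFreq_prob, LogicalTree.pathProb_root]; ring
      _ = upFreq μ G.C := by rw [upFreq_prob_estimate hμ]
      _ < ∑ x, μ x := upFreq_C_lt_sum hμ
      _ = 1 := hsum

open Classical in
theorem sum_mul_log_prob (hprob : ∀ x, G.prob α x ≠ 0) (μ : G.Outcome → ℝ) :
    ∑ x, μ x * Real.log (G.prob α x) =
      G.up.logLikelihood (upFreq μ) (α ∘ G.upLink) G.C +
        upFreq μ G.C * Real.log (α G.linkCD) +
        G.down.logLikelihood (downFreq μ) (α ∘ G.downLink) G.D +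
        (∑ x, μ x - upFreq μ G.C) * Real.log (1 - G.up.reachProb (α ∘ G.upLink) G.C *
          (α G.linkCD * G.down.reachProb (α ∘ G.downLink) G.D)) := by
  have hfactors (x : G.Outcome) (hx : ∃ r s, x.1 r s) := prob_of_nonzero α hx ▸ hprob x
  rw [upFreq, downFreq,
    ← LogicalTree.sum_mul_log_patternProb
      fun x hx => left_ne_zero_of_mul (hfactors x (hit_sourceMarks_C.1 hx)),
    ← LogicalTree.sum_mul_log_patternProb fun x hx =>
      right_ne_zero_of_mul (right_ne_zero_of_mul (hfactors x (hit_receiverMarks_D.1 hx))),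
    ← upFreq, sum_sub_upFreq_C, upFreq, LogicalTree.hitFreq, Finset.sum_mul, Finset.sum_mul,
    ← Finset.sum_filter_add_sum_filter_not _ fun x : G.Outcome => ∃ r s, x.1 r s]
  simp only [hit_sourceMarks_C, hit_receiverMarks_D, ← Finset.sum_add_distrib]
  congr 1
  · refine Finset.sum_congr rfl fun x hx => ?_
    have hx := (Finset.mem_filter.1 hx).2
    have h := hfactors x hx
    rw [prob_of_nonzero α hx, Real.log_mul (left_ne_zero_of_mul h) (right_ne_zero_of_mul h),
      Real.log_mul (left_ne_zero_of_mul (right_ne_zero_of_mul h))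
        (right_ne_zero_of_mul (right_ne_zero_of_mul h))]
    ring
  · exact Finset.sum_congr rfl fun x hx => by rw [prob_of_zero α (Finset.mem_filter.1 hx).2]

open Classical in
theorem likelihood_pos (hprob : ∀ x, 0 < G.prob α x) (N : G.Outcome → ℕ) :
    0 < G.likelihood N α :=
  Finset.prod_pos fun x _ => pow_pos (hprob x) _

open Classical in
theorem log_likelihood (N : G.Outcome → ℕ) (hprob : ∀ x, G.prob α x ≠ 0) :
    Real.log (G.likelihood N α) =
      (∑ x, (N x : ℝ)) * ∑ x, relativeFreq N x * Real.log (G.prob α x) := by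
  rw [likelihood, Real.log_prod fun x _ => pow_ne_zero _ (hprob x), Finset.mul_sum]
  refine Finset.sum_congr rfl fun x _ => ?_
  rw [Real.log_pow, ← mul_assoc, sum_mul_relativeFreq]

open Classical in
theorem sum_mul_log_prob_estimate (hμ : ∀ x, 0 < μ x) (hsum : ∑ x, μ x = 1)
    (hprob : ∀ x, G.prob α x ≠ 0) :
    ∑ x, μ x * Real.log (G.prob α x) =
      ∑ x, G.prob (G.estimate μ) x * Real.log (G.prob α x) := by
  simp only [sum_mul_log_prob hprob, upFreq_prob_estimate hμ, downFreq_prob_estimate hμ, hsum,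
    sum_prob]

open Classical in
theorem likelihood_lt_likelihood_estimate (hN : ∀ x, 0 < N x) (hβ : β ∈ G.rates)
    (hne : G.prob β ≠ G.prob (G.estimate (relativeFreq N))) :
    G.likelihood N β < G.likelihood N (G.estimate (relativeFreq N)) := by
  have hμ := relativeFreq_pos hN
  have hsum := sum_relativeFreq ⟨G.outcome fun _ => false, hN _⟩
  have hpos := prob_estimate_pos hμ hsum
  by_cases hzero : ∃ x, G.prob β x = 0
  · obtain ⟨x, hx⟩ := hzero
    rw [likelihood, Finset.prod_eq_zero (Finset.mem_univ x) (by rw [hx, zero_pow (hN x).ne'])]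
    exact likelihood_pos hpos N
  have hβpos (x : G.Outcome) : 0 < G.prob β x :=
    (prob_nonneg hβ x).lt_of_ne' fun hx => hzero ⟨x, hx⟩
  rw [← Real.log_lt_log_iff (likelihood_pos hβpos N) (likelihood_pos hpos N),
    log_likelihood N fun x => (hβpos x).ne', log_likelihood N fun x => (hpos x).ne',
    sum_mul_log_prob_estimate hμ hsum fun x => (hβpos x).ne',
    sum_mul_log_prob_estimate hμ hsum fun x => (hpos x).ne']
  have hcount : 0 < ∑ x, (N x : ℝ) := Finset.sum_pos (fun x _ => Nat.cast_pos.2 (hN x))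
    ⟨G.outcome fun _ => false, Finset.mem_univ _⟩
  exact mul_lt_mul_of_pos_left (sum_mul_log_lt_sum_mul_log (fun x => (hpos x).le) hβpos
    ((sum_prob _).trans (sum_prob β).symm) hne.symm) hcount

open Classical in
theorem isMLE_estimate (hN : ∀ x, 0 < N x) (hrates : G.estimate (relativeFreq N) ∈ G.rates) :
    G.IsMLE N (G.estimate (relativeFreq N)) := by
  refine ⟨hrates, fun β hβ => ?_⟩
  by_cases heq : G.prob β = G.prob (G.estimate (relativeFreq N))
  · rw [likelihood, heq, likelihood]
  · exact (likelihood_lt_likelihood_estimate hN hβ heq).le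

open Classical in
theorem IsMLE.eq_estimate (hN : ∀ x, 0 < N x) (hrates : G.estimate (relativeFreq N) ∈ G.rates)
    (hβ : G.IsMLE N β) : β = G.estimate (relativeFreq N) := by
  have hμ := relativeFreq_pos hN
  have heq : G.prob β = G.prob (G.estimate (relativeFreq N)) := by
    by_contra hne
    exact (likelihood_lt_likelihood_estimate hN hβ.1 hne).not_ge (hβ.2 _ hrates)
  have hpos : ∀ x, 0 < G.prob β x := heq ▸ prob_estimate_pos hμ
    (sum_relativeFreq ⟨G.outcome fun _ => false, hN _⟩)
  rw [← estimate_prob hβ.1 hpos]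
  exact estimate_congr (heq ▸ upFreq_prob_estimate hμ) (heq ▸ downFreq_prob_estimate hμ)

end Likelihood

end CodedTree

section RandomExperiments

variable {Ω S : Type*} [MeasurableSpace Ω] [MeasurableSpace S] {P : Measure Ω}

theorem identDistrib_of_measureReal_preimage_singleton [IsFiniteMeasure P] [Countable S]
    [MeasurableSingletonClass S] {X Y : Ω → S} (hX : AEMeasurable X P) (hY : AEMeasurable Y P)
    (h : ∀ x, P.real (X ⁻¹' {x}) = P.real (Y ⁻¹' {x})) : IdentDistrib X Y P P where
  aemeasurable_fst := hX
  aemeasurable_snd := hY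
  map_eq := Measure.ext_of_singleton fun x => by
    rw [Measure.map_apply_of_aemeasurable hX (measurableSet_singleton x),
      Measure.map_apply_of_aemeasurable hY (measurableSet_singleton x)]
    exact (measureReal_eq_measureReal_iff).1 (h x)

theorem ae_tendsto_frequency [IsFiniteMeasure P] {X : ℕ → Ω → S}
    (hindep : Pairwise fun s t => IndepFun (X s) (X t) P)
    (hident : ∀ t, IdentDistrib (X t) (X 0) P P) {A : Set S} [DecidablePred (· ∈ A)]
    (hA : MeasurableSet A) :
    ∀ᵐ ω ∂P, Tendsto (fun n : ℕ => (((Finset.range n).filter fun t => X t ω ∈ A).card : ℝ) / n)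
      atTop (nhds (P.real (X 0 ⁻¹' A))) := by
  have hmeas : Measurable (A.indicator (1 : S → ℝ)) := measurable_one.indicator hA
  have hX := (hident 0).aemeasurable_fst
  have hmean : ∫ ω, A.indicator 1 (X 0 ω) ∂P = P.real (X 0 ⁻¹' A) := by
    rw [← integral_map hX hmeas.aestronglyMeasurable, integral_indicator_one hA,
      map_measureReal_apply_of_aemeasurable hX hA]
  have hint : Integrable (fun ω => A.indicator (1 : S → ℝ) (X 0 ω)) P :=
    ((integrable_const (1 : ℝ)).indicator hA).comp_aemeasurable hX
  have hlaw := strong_law_ae_real (fun t ω => A.indicator (1 : S → ℝ) (X t ω)) hint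
    (fun s t hst => (hindep hst).comp hmeas hmeas) fun t => (hident t).comp hmeas
  rw [hmean] at hlaw
  refine hlaw.mono fun ω hω => hω.congr fun n => ?_
  simp only [Set.indicator_apply, Pi.one_apply, Finset.sum_boole]

end RandomExperiments

namespace CodedTree

section Consistency

variable {U W : Type*} [Fintype U] [Fintype W] {G : CodedTree U W} {α : G.Link → ℝ}

open Classical in
theorem sum_counts (X : ℕ → G.Outcome) (n : ℕ) : ∑ x, G.counts X n x = n := by
  have hfibers := Finset.card_eq_sum_card_fiberwise (f := X) (s := Finset.range n)
    (t := Finset.univ) fun t _ => Finset.mem_coe.2 (Finset.mem_univ (X t))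
  rw [Finset.card_range] at hfibers
  refine (Finset.sum_congr rfl fun x _ => ?_).trans hfibers.symm
  rw [counts]
  congr!

open Classical in
theorem ae_tendsto_relativeFreq_counts {Ω : Type*} [MeasurableSpace Ω] {P : Measure Ω}
    [IsFiniteMeasure P] {X : ℕ → Ω → G.Outcome} (hX : ∀ t, AEMeasurable (X t) P)
    (hindep : Pairwise fun s t => IndepFun (X s) (X t) P)
    {q : G.Outcome → ℝ} (hq : ∀ t x, P.real (X t ⁻¹' {x}) = q x) :
    ∀ᵐ ω ∂P, ∀ x, Tendsto (fun n => relativeFreq (G.counts (fun t => X t ω) n) x) atTop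
      (nhds (q x)) := by
  refine ae_all_iff.2 fun x => ?_
  have hident (t : ℕ) : IdentDistrib (X t) (X 0) P P :=
    identDistrib_of_measureReal_preimage_singleton (hX t) (hX 0)
      fun y => (hq t y).trans (hq 0 y).symm
  have hfreq := ae_tendsto_frequency hindep hident (measurableSet_singleton x)
  rw [hq] at hfreq
  refine hfreq.mono fun ω hω => hω.congr fun n => ?_
  rw [relativeFreq, ← Nat.cast_sum, sum_counts, counts]
  simp only [Set.mem_singleton_iff]
  congr!

open Classical in
theorem eventually_counts_pos {X : ℕ → G.Outcome} {q : G.Outcome → ℝ} (hq : ∀ x, 0 < q x)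
    (hX : ∀ x, Tendsto (fun n => relativeFreq (G.counts X n) x) atTop (nhds (q x))) :
    ∀ᶠ n in atTop, ∀ x, 0 < G.counts X n x := by
  refine eventually_all.2 fun x => ((hX x).eventually_const_lt (hq x)).mono fun n hn => ?_
  refine Nat.pos_of_ne_zero fun hzero => hn.ne' ?_
  rw [relativeFreq, hzero, Nat.cast_zero, zero_div]

theorem eventually_estimate_mem_rates {β : Type*} {l : Filter β} {u : β → G.Outcome → ℝ}
    (hα : ∀ e, 0 < α e ∧ α e < 1)
    (hu : ∀ x, Tendsto (fun n => u n x) l (nhds (G.prob α x))) :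
    ∀ᶠ n in l, G.estimate (u n) ∈ G.rates := by
  have hprob := prob_pos hα
  refine eventually_all.2 fun e => ?_
  have hlim := tendsto_estimate hprob hu e
  rw [estimate_prob (fun e => ⟨(hα e).1, (hα e).2.le⟩) hprob] at hlim
  filter_upwards [hlim.eventually_const_lt (hα e).1, hlim.eventually_lt_const (hα e).2]
    with n hpos hlt
  exact ⟨hpos, hlt.le⟩

end Consistency

end CodedTree

theorem mainTheorem3_general {U W : Type*} [Fintype U] [Fintype W] (G : CodedTree U W) :
    (∀ N : G.Outcome → ℕ, (∀ x, 0 < N x) →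
      (∃! α : G.Link → ℝ, G.IsAlgorithmOutput N α) ∧
      ∀ α : G.Link → ℝ, G.IsAlgorithmOutput N α → α ∈ G.rates →
        G.IsMLE N α ∧ ∀ β, G.IsMLE N β → β = α) ∧
    (∀ α₀ : G.Link → ℝ, (∀ e, 0 < α₀ e ∧ α₀ e < 1) →
      ∀ {Ω : Type*} [MeasurableSpace Ω] (P : Measure Ω) [IsFiniteMeasure P]
        (X : ℕ → Ω → G.Outcome),
        (∀ t, AEMeasurable (X t) P) → (Pairwise fun s t => IndepFun (X s) (X t) P) →
        (∀ t x, P.real (X t ⁻¹' {x}) = G.prob α₀ x) →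
        ∀ᵐ ω ∂P, ∀ᶠ n in atTop,
          (∀ x, 0 < G.counts (fun t => X t ω) n x) ∧
          ∃ α : G.Link → ℝ, G.IsAlgorithmOutput (G.counts (fun t => X t ω) n) α ∧
            α ∈ G.rates ∧
            G.IsMLE (G.counts (fun t => X t ω) n) α ∧
            ∀ β, G.IsMLE (G.counts (fun t => X t ω) n) β → β = α) := by
  have hunique (N : G.Outcome → ℕ) (hN : ∀ x, 0 < N x) (α : G.Link → ℝ)
      (hα : G.IsAlgorithmOutput N α) (hrates : α ∈ G.rates) :
      G.IsMLE N α ∧ ∀ β, G.IsMLE N β → β = α := by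
    obtain rfl := (CodedTree.isAlgorithmOutput_iff hN).1 hα
    exact ⟨CodedTree.isMLE_estimate hN hrates, fun β hβ => hβ.eq_estimate hN hrates⟩
  refine ⟨fun N hN => ⟨?_, hunique N hN⟩, fun α₀ hα₀ Ω _ P _ X hX hindep hq => ?_⟩
  · simp only [CodedTree.isAlgorithmOutput_iff hN, existsUnique_eq]
  filter_upwards [CodedTree.ae_tendsto_relativeFreq_counts hX hindep hq] with ω hω
  filter_upwards [CodedTree.eventually_counts_pos (CodedTree.prob_pos hα₀) hω,
    CodedTree.eventually_estimate_mem_rates hα₀ hω] with n hcounts hrates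
  have houtput := (CodedTree.isAlgorithmOutput_iff hcounts).2 rfl
  exact ⟨hcounts, _, houtput, hrates, hunique _ hcounts _ houtput hrates⟩

theorem mainTheorem3 {U W : Type*} [Fintype U] [Fintype W] (G : CodedTree U W) :
    (∀ N : G.Outcome → ℕ, (∀ x, 0 < N x) →
      (∃! α : G.Link → ℝ, G.IsAlgorithmOutput N α) ∧
      ∀ α : G.Link → ℝ, G.IsAlgorithmOutput N α → α ∈ G.rates →
        G.IsMLE N α ∧ ∀ β, G.IsMLE N β → β = α) ∧
    (∀ α₀ : G.Link → ℝ, (∀ e, 0 < α₀ e ∧ α₀ e < 1) →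
      ∀ {Ω : Type*} [MeasurableSpace Ω] (P : Measure Ω) [IsProbabilityMeasure P]
        (X : ℕ → Ω → G.Outcome),
        (∀ t, Measurable (X t)) → iIndepFun X P →
        (∀ t x, P.real (X t ⁻¹' {x}) = G.prob α₀ x) →
        ∀ᵐ ω ∂P, ∀ᶠ n in atTop,
          (∀ x, 0 < G.counts (fun t => X t ω) n x) ∧
          ∃ α : G.Link → ℝ, G.IsAlgorithmOutput (G.counts (fun t => X t ω) n) α ∧
            α ∈ G.rates ∧
            G.IsMLE (G.counts (fun t => X t ω) n) α ∧
            ∀ β, G.IsMLE (G.counts (fun t => X t ω) n) β → β = α) := by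
  exact (mainTheorem3_general G).imp_right fun h α₀ hα₀ _ _ P _ X hX hindep =>
    h α₀ hα₀ P X (fun t => (hX t).aemeasurable) fun _ _ hst => hindep.indepFun hst
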